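/- Let $V$ be a finite set of agents and let $\mathcal X_1,\dots,\mathcal X_m$ be finitely many undirected graphs with common vertex set $V$, each with symmetric edge weights $a^{(k)}_{ij}=a^{(k)}_{ji}$, which are positive if $\{i,j\}$ is an edge of $\mathcal X_k$ and $0$ otherwise. Let $\sigma:[t_0,\infty)\to\{1,\dots,m\}$ be a switching signal which is piecewise constant and right-continuous and has a minimum dwell time, i.e. there is $\tau_{\min}>0$ such that any two distinct switching times (discontinuities of $\sigma$ in $(t_0,\infty)$) are at least $\tau_{\min}$ apart. Suppose that $\sigma$ generates a $\tau$-jointly connected graph for some $0<\tau<\infty$: for every $\bar t\ge t_0$, the graph on $V$ whose edge set is the union of the edge sets of the graphs $\mathcal X_{\sigma(t)}$, $t\in[\bar t,\bar t+\tau]$, is connected (the individual graphs may be disconnected). Let $f:\mathbb R\to\mathbb R$ be continuous and such that the origin is a globally asymptotically stable equilibrium of $\dot y=-f(y)$. Consider the switched closed-loop system on $\mathbb R^V$ that the protocol $u_i=f(e_i)$ produces for the agents $\dot x_i=u_i$, $$\dot x_i(t)=f(e_i(t)),\qquad e_i(t)=\sum_{j\in V}a^{(\sigma(t))}_{ij}\,\bigl(x_j(t)-x_i(t)\bigr),\qquad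 i\in V,\ t\ge t_0,$$ whose solutions are understood to be locally absolutely continuous functions that satisfy the equations at almost every time (no uniqueness of solutions is assumed). Then the consensus state is a globally asymptotically stable equilibrium of this system. That is, with $\mathcal C=\{x\in\mathbb R^V: x_i=x_j \text{ for all } i,j\in V\}$: 1. every point of $\mathcal C$ is an equilibrium; 2. from every initial state at time $t_0$ there starts a solution on $[t_0,\infty)$, and every solution on a bounded interval $[t_0,T)$ extends to a solution on $[t_0,\infty)$; 3. for every $\varepsilon>0$ there is $\delta>0$ such that, for every $c\in\mathcal C$ and every solution $x$ on $[t_0,\infty)$ with $\|x(t_0)-c\|<\delta$, one has $\|x(t)-c\|<\varepsilon$ for all $t\ge t_0$; 4. every solution on $[t_0,\infty)$ converges, as $t\to\infty$, to a point of $\mathcal C$. The global asymptotic stability of the origin for $\dot y=-f(y)$ is understood in the same sense, with $\{0\}$ in place of $\mathcal C$ and initial time $0$. -/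

import Mathlib

open Set Filter Topology MeasureTheory

/-! ### Solutions of (possibly time-varying) differential equations -/

section Dynamics

variable {E : Type*} [NormedAddCommGroup E] [NormedSpace ℝ E]

/-- `x` solves `ẋ(t) = v t (x(t))` on `[t₀, T]` in the sense of Carathéodory: it is absolutely
continuous there and satisfies the equation at almost every time. For a right-hand side which is
continuous in the state this is the same as being a solution in the sense of Filippov. -/
def IsSolutionOn (v : ℝ → E → E) (t₀ T : ℝ) (x : ℝ → E) : Prop :=
  AbsolutelyContinuousOnInterval x t₀ T ∧
    ∀ᵐ t, t ∈ Ioo t₀ T → HasDerivAt x (v t (x t)) t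

/-- `x` solves `ẋ(t) = v t (x(t))` on `[t₀, ∞)`. -/
def IsGlobalSolution (v : ℝ → E → E) (t₀ : ℝ) (x : ℝ → E) : Prop :=
  ∀ T, t₀ < T → IsSolutionOn v t₀ T x

/-- `A` is a globally asymptotically stable set of equilibria of `ẋ(t) = v t (x(t))` with initial
time `t₀`. For `A = {a}` this is global asymptotic stability of the equilibrium `a`. Solutions are
not required to be unique: the properties are asked of all of them. -/
structure IsGloballyAsymptoticallyStable (v : ℝ → E → E) (t₀ : ℝ) (A : Set E) : Prop where
  /-- Every point of `A` is an equilibrium. -/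
  equilibrium : ∀ a ∈ A, IsGlobalSolution v t₀ (fun _ => a)
  /-- From every initial state there starts a solution on `[t₀, ∞)`. -/
  exists_solution : ∀ x₀ : E, ∃ x, IsGlobalSolution v t₀ x ∧ x t₀ = x₀
  /-- No solution ends in finite time: a solution on `[t₀, T)` extends to one on `[t₀, ∞)`. -/
  extends_solution : ∀ T, t₀ < T → ∀ x : ℝ → E, (∀ s ∈ Ioo t₀ T, IsSolutionOn v t₀ s x) →
    ∃ y, IsGlobalSolution v t₀ y ∧ EqOn y x (Ico t₀ T)
  /-- Lyapunov stability of the points of `A`, uniformly over `A`. -/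
  stable : ∀ ε > 0, ∃ δ > 0, ∀ a ∈ A, ∀ x, IsGlobalSolution v t₀ x → dist (x t₀) a < δ →
    ∀ t, t₀ ≤ t → dist (x t) a < ε
  /-- Global attractivity: every solution converges to a point of `A`. -/
  attractive : ∀ x, IsGlobalSolution v t₀ x → ∃ a ∈ A, Tendsto x atTop (𝓝 a)

end Dynamics

/-! ### Dynamic networks -/

/-- An undirected graph on `V` with positive edge weights, given by its adjacency matrix
`weight i j = a_{ij}`, which vanishes off the edges. -/
structure WeightedGraph (V : Type*) where
  /-- The underlying undirected graph. -/
  graph : SimpleGraph V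
  /-- The entries of the adjacency matrix. -/
  weight : V → V → ℝ
  weight_symm : ∀ i j, weight i j = weight j i
  weight_pos : ∀ i j, graph.Adj i j → 0 < weight i j
  weight_eq_zero : ∀ i j, ¬ graph.Adj i j → weight i j = 0

/-- `t` is a switching time of the signal `σ` on `[t₀, ∞)`. -/
def IsSwitchingTime {m : ℕ} (σ : ℝ → Fin m) (t₀ t : ℝ) : Prop :=
  t₀ < t ∧ ¬ ∀ᶠ s in 𝓝 t, σ s = σ t

/-- `σ` (restricted to `[t₀, ∞)`) is a switching signal with a positive minimum dwell time: the
index chosen at a time stays active immediately afterwards, and any two switching times are at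
least `τmin` apart. -/
def IsSwitchingSignal {m : ℕ} (σ : ℝ → Fin m) (t₀ : ℝ) : Prop :=
  (∀ t, t₀ ≤ t → ∀ᶠ s in 𝓝[≥] t, σ s = σ t) ∧
    ∃ τmin > 0, ∀ s t, IsSwitchingTime σ t₀ s → IsSwitchingTime σ t₀ t → s < t → τmin ≤ t - s

/-- The signal `σ` generates a `τ`-jointly connected graph: the union of the graphs that are
active in any time window of length `τ` is connected. -/
def IsJointlyConnected {V : Type*} {m : ℕ} (X : Fin m → WeightedGraph V) (σ : ℝ → Fin m)
    (t₀ τ : ℝ) : Prop :=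
  ∀ tbar, t₀ ≤ tbar → (⨆ t ∈ Icc tbar (tbar + τ), (X (σ t)).graph).Connected

/-- The consensus error `e_i = ∑_j a_{ij} (x_j - x_i)` of the agent `i`. -/
def consensusError {V : Type*} [Fintype V] (G : WeightedGraph V) (x : V → ℝ) (i : V) : ℝ :=
  ∑ j, G.weight i j * (x j - x i)

/-- The closed loop `ẋ_i = u_i = f(e_i)` of the network whose topology is `X (σ t)`
at time `t`. -/
def closedLoop {V : Type*} [Fintype V] {m : ℕ} (X : Fin m → WeightedGraph V) (σ : ℝ → Fin m)
    (f : ℝ → ℝ) (t : ℝ) (x : V → ℝ) : V → ℝ :=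
  fun i => f (consensusError (X (σ t)) x i)

/-- The consensus states `x_1 = ... = x_n`. -/
def consensusSet (V : Type*) : Set (V → ℝ) :=
  {x | ∀ i j, x i = x j}

/-! Asymptotic stability of the origin for the scalar equation forces `f` to vanish only at `0` and
to have the sign of its argument. An agent at the maximum of the network has nonpositive consensus
error, so the maximum never increases and, by reflection, the minimum never decreases
(`IsRightSolutionOn.forall_le`). This bounds every solution, hence its velocity, and yields global
existence, extension and stability with `δ = ε`.

For convergence, let `c` be the limit of the maximum and suppose that the minimum stays below some
`c' < c`. On a stretch of constant topology, the strong maximum principle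
(`IsRightSolutionOn.le_of_reachable`) pulls every agent connected to a low one strictly below `c`.
As `f` is merely continuous, a uniform margin comes from compactness of the set of solutions rather
than from an estimate (`eventually_le_sub_of_reachable`). Over stretches that cover a window of
length `τ`, joint connectivity adds a new agent to the low ones (`exists_card_le_low`). Finitely
many rounds keep the margin positive and leave no agent near the maximum, a contradiction.

Barrier arguments need a derivative at every time, so Carathéodory solutions are first turned into
solutions with a right derivative everywhere. -/

/-! ### Right-differentiable solutions versus Carathéodory solutions -/

section RightSolutions

variable {E : Type*} [NormedAddCommGroup E] [NormedSpace ℝ E]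

/-- `x` is continuous on `[a, b]` and has the right derivative `v t (x t)` at every time
`t ∈ [a, b)`. -/
def IsRightSolutionOn (v : ℝ → E → E) (a b : ℝ) (x : ℝ → E) : Prop :=
  ContinuousOn x (Icc a b) ∧ ∀ t ∈ Ico a b, HasDerivWithinAt x (v t (x t)) (Ici t) t

theorem IsRightSolutionOn.mono {v : ℝ → E → E} {a b a' b' : ℝ} {x : ℝ → E}
    (h : IsRightSolutionOn v a b x) (ha : a ≤ a') (hb : b' ≤ b) :
    IsRightSolutionOn v a' b' x :=
  ⟨h.1.mono (Icc_subset_Icc ha hb), fun t ht => h.2 t (Ico_subset_Ico ha hb ht)⟩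

theorem IsRightSolutionOn.congr_field {v w : ℝ → E → E} {a b : ℝ} {x : ℝ → E}
    (h : IsRightSolutionOn v a b x) (hvw : ∀ t ∈ Ico a b, v t (x t) = w t (x t)) :
    IsRightSolutionOn w a b x :=
  ⟨h.1, fun t ht => hvw t ht ▸ h.2 t ht⟩

theorem HasDerivWithinAt.congr_of_eqOn_Ico {x y : ℝ → E} {y' : E} {t c : ℝ}
    (h : HasDerivWithinAt y y' (Ici t) t) (htc : t < c) (hxy : EqOn x y (Ico t c)) :
    HasDerivWithinAt x y' (Ici t) t :=
  h.congr_of_eventuallyEq (Filter.mem_of_superset (Ico_mem_nhdsGE htc) hxy)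
    (hxy ⟨le_rfl, htc⟩)

theorem IsRightSolutionOn.congr {v : ℝ → E → E} {a b : ℝ} {x y : ℝ → E}
    (h : IsRightSolutionOn v a b x) (hxy : EqOn y x (Icc a b)) :
    IsRightSolutionOn v a b y := by
  refine ⟨h.1.congr hxy, fun t ht => ?_⟩
  rw [hxy ⟨ht.1, ht.2.le⟩]
  exact (h.2 t ht).congr_of_eqOn_Ico ht.2 fun s hs => hxy ⟨ht.1.trans hs.1, hs.2.le⟩

theorem IsRightSolutionOn.comp_add {F : E → E} {d s : ℝ} {x : ℝ → E}
    (h : IsRightSolutionOn (fun _ => F) s (s + d) x) :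
    IsRightSolutionOn (fun _ => F) 0 d (fun t => x (s + t)) := by
  refine ⟨h.1.comp (by fun_prop) fun t ht => ⟨by linarith [ht.1], by linarith [ht.2]⟩,
    fun t ht => ?_⟩
  have h1 := h.2 (s + t) ⟨by linarith [ht.1], by linarith [ht.2]⟩
  have h2 : HasDerivWithinAt (fun t => s + t) 1 (Ici t) t :=
    ((hasDerivAt_id t).const_add s).hasDerivWithinAt
  have h3 := HasDerivWithinAt.scomp t h1 h2 fun r hr => by
    simpa using hr
  simpa [Function.comp_def] using h3

/-- Two solutions on adjacent intervals can be concatenated. -/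
theorem IsRightSolutionOn.concat {v : ℝ → E → E} {a b : ℝ} {x y : ℝ → E}
    (hx : IsRightSolutionOn v a b x) (hab : a ≤ b) (hxy : x b = y b) :
    ∃ z, EqOn z x (Iic b) ∧ EqOn z y (Ici b) ∧
      ∀ c, b ≤ c → IsRightSolutionOn v b c y → IsRightSolutionOn v a c z := by
  classical
  set z : ℝ → E := fun t => if t ≤ b then x t else y t with hz
  have hzx : EqOn z x (Iic b) := fun t ht => if_pos ht
  have hzy : EqOn z y (Ici b) := fun t ht => by
    rcases eq_or_lt_of_le (show b ≤ t from ht) with rfl | h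
    · simp [hz, hxy]
    · exact if_neg (not_le.2 h)
  refine ⟨z, hzx, hzy, fun c hbc hy => ⟨?_, fun t ht => ?_⟩⟩
  · rw [← Icc_union_Icc_eq_Icc hab hbc]
    exact (hx.1.congr fun t ht => hzx ht.2).union_of_isClosed
      (hy.1.congr fun t ht => hzy ht.1) isClosed_Icc isClosed_Icc
  · rcases lt_or_ge t b with h | h
    · rw [hzx h.le]
      exact (hx.2 t ⟨ht.1, h⟩).congr_of_eqOn_Ico h fun s hs => hzx hs.2.le
    · rw [hzy h]
      exact (hy.2 t ⟨h, ht.2⟩).congr_of_eqOn_Ico ht.2 fun s hs => hzy (h.trans hs.1)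

/-- If solutions exist for a uniform time from all initial data, then they exist globally. -/
theorem exists_forall_isRightSolutionOn {v : ℝ → E → E} {t₀ d : ℝ} (hd : 0 < d)
    (h : ∀ T, t₀ ≤ T → ∀ x₀, ∃ x, IsRightSolutionOn v T (T + d) x ∧ x T = x₀) {T : ℝ}
    (hT : t₀ ≤ T) (x₀ : E) : ∃ x, (∀ b, IsRightSolutionOn v T b x) ∧ x T = x₀ := by
  have hTn : ∀ n : ℕ, T ≤ T + n * d := fun n => by
    have : 0 ≤ (n : ℝ) * d := by positivity
    linarith
  have hstep : ∀ (n : ℕ) (x : ℝ → E), IsRightSolutionOn v T (T + n * d) x →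
      ∃ z, IsRightSolutionOn v T (T + (n + 1 : ℕ) * d) z ∧ EqOn z x (Iic (T + n * d)) := by
    intro n x hx
    obtain ⟨y, hy, hy₀⟩ := h (T + n * d) (hT.trans (hTn n)) (x (T + n * d))
    obtain ⟨z, hzx, -, hz⟩ := hx.concat (hTn n) hy₀.symm
    refine ⟨z, ?_, hzx⟩
    have := hz _ (by linarith) hy
    rwa [show T + n * d + d = T + (n + 1 : ℕ) * d by push_cast; ring] at this
  choose! next hnext hnext' using hstep
  obtain ⟨y, -, hy₀⟩ := h T hT x₀
  -- `S 0` only has to be right at the single point `T`, where it supplies the initial value.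
  let S : ℕ → ℝ → E := fun n => Nat.rec y next n
  have hS : ∀ n : ℕ, IsRightSolutionOn v T (T + n * d) (S n) := by
    intro n
    induction n with
    | zero =>
      simp only [Nat.cast_zero, zero_mul, add_zero]
      exact ⟨by simp, by simp⟩
    | succ n ih => exact hnext n _ ih
  have hSS : ∀ n k : ℕ, EqOn (S (n + k)) (S n) (Iic (T + n * d)) := by
    intro n k
    induction k with
    | zero => exact fun _ _ => rfl
    | succ k ih =>
      intro t ht
      rw [← ih ht]
      refine hnext' (n + k) _ (hS _) ?_
      have : 0 ≤ (k : ℝ) * d := by positivity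
      have ht' : t ≤ T + n * d := ht
      change t ≤ T + (n + k : ℕ) * d
      push_cast
      linarith
  set z : ℝ → E := fun t => S (⌈(t - T) / d⌉₊) t with hz
  have hzS : ∀ n : ℕ, EqOn z (S n) (Iic (T + n * d)) := by
    intro n t ht
    have h1 : t ≤ T + ⌈(t - T) / d⌉₊ * d := by
      have := (div_le_iff₀ hd).1 (Nat.le_ceil ((t - T) / d))
      linarith
    have h2 : ⌈(t - T) / d⌉₊ ≤ n := by
      refine Nat.ceil_le.2 ((div_le_iff₀ hd).2 ?_)
      have ht' : t ≤ T + n * d := ht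
      linarith
    obtain ⟨k, rfl⟩ := Nat.exists_eq_add_of_le h2
    exact (hSS _ k h1).symm
  refine ⟨z, fun b => ?_, ?_⟩
  · obtain ⟨n, hn⟩ := exists_nat_ge ((b - T) / d)
    have hb : b ≤ T + n * d := by linarith [(div_le_iff₀ hd).1 hn]
    exact ((hS n).congr fun t ht => hzS n ht.2).mono le_rfl hb
  · have := hzS 0 (show T ≤ T + (0 : ℕ) * d by simp)
    rw [this]; exact hy₀

/-- A Carathéodory solution has a right derivative wherever the field is, locally to the right,
time-independent and continuous in the state. -/
theorem IsSolutionOn.isRightSolutionOn [CompleteSpace E] {v : ℝ → E → E} {a b : ℝ} {x : ℝ → E}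
    (h : IsSolutionOn v a b x) (hab : a ≤ b)
    (hv : ∀ t ∈ Ico a b, ∃ F : E → E, Continuous F ∧ ∀ᶠ s in 𝓝[≥] t, v s = F) :
    IsRightSolutionOn v a b x := by
  have hcont : ContinuousOn x (Icc a b) := by
    simpa [uIcc_of_le hab] using h.1.continuousOn
  refine ⟨hcont, fun t ht => ?_⟩
  obtain ⟨F, hF, hvF⟩ := hv t ht
  obtain ⟨c₀, hc₀, hsub⟩ := mem_nhdsGE_iff_exists_Ico_subset.1 hvF
  set c := min c₀ b
  have htc : t < c := lt_min hc₀ ht.2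
  have hvc : ∀ s ∈ Ico t c, v s = F := fun s hs => hsub ⟨hs.1, hs.2.trans_le (min_le_left _ _)⟩
  have hxc : ContinuousOn x (Icc t c) :=
    hcont.mono (Icc_subset_Icc ht.1 (min_le_right _ _))
  -- `g` is `F ∘ x` on `[t, c]`, made continuous on all of `ℝ`. Its primitive `P` is then `C¹`, and
  -- `x - P` is absolutely continuous with derivative zero a.e., hence constant.
  set g : ℝ → E := fun s => F (IccExtend htc.le ((Icc t c).domRestrict x) s) with hg
  have hgc : Continuous g := hF.comp hxc.domRestrict.Icc_extend'
  have hgx : ∀ s ∈ Icc t c, g s = F (x s) := fun s hs => by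
    simp only [hg, IccExtend_of_mem htc.le _ hs, domRestrict_apply]
  set P : ℝ → E := fun u => ∫ s in t..u, g s with hP
  have hPd : ∀ u, HasDerivAt P (g u) u := fun u => hgc.integral_hasStrictDerivAt t u |>.hasDerivAt
  have hPc : ContDiff ℝ 1 P := by
    rw [contDiff_one_iff_deriv]
    refine ⟨fun u => (hPd u).differentiableAt, ?_⟩
    rwa [show deriv P = g from funext fun u => (hPd u).deriv]
  have hac : AbsolutelyContinuousOnInterval (fun u => x u - P u) t c := by
    refine AbsolutelyContinuousOnInterval.sub (h.1.mono ?_)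
      (hPc.contDiffOn.absolutelyContinuousOnInterval)
    rw [uIcc_of_le hab, uIcc_of_le htc.le]
    exact Icc_subset_Icc ht.1 (min_le_right _ _)
  have hae : ∀ᵐ u, u ∈ uIcc t c → HasDerivAt (fun u => x u - P u) 0 u := by
    have h1 : ∀ᵐ u : ℝ, u ≠ t := by simp [ae_iff]
    have h2 : ∀ᵐ u : ℝ, u ≠ c := by simp [ae_iff]
    filter_upwards [h.2, h1, h2] with u hu hut huc huI
    rw [uIcc_of_le htc.le] at huI
    have h3 : t < u := lt_of_le_of_ne huI.1 hut.symm
    have h4 : u < c := lt_of_le_of_ne huI.2 huc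
    have h5 := (hu ⟨ht.1.trans_lt h3, h4.trans_le (min_le_right _ _)⟩).sub (hPd u)
    rwa [hvc u ⟨h3.le, h4⟩, hgx u huI, sub_self] at h5
  obtain ⟨C, hC⟩ := hac.const_of_ae_hasDerivAt_zero hae
  rw [uIcc_of_le htc.le] at hC
  have hfin : HasDerivWithinAt (fun u => P u + C) (g t) (Ici t) t :=
    ((hPd t).add_const C).hasDerivWithinAt
  rw [hgx t ⟨le_rfl, htc.le⟩, ← hvc t ⟨le_rfl, htc⟩] at hfin
  refine hfin.congr_of_eqOn_Ico htc fun s hs => ?_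
  exact (add_eq_of_eq_sub' (hC s ⟨hs.1, hs.2.le⟩).symm).symm

theorem IsRightSolutionOn.norm_sub_le {v : ℝ → E → E} {a b C : ℝ} {x : ℝ → E}
    (h : IsRightSolutionOn v a b x) (hC : ∀ t ∈ Ico a b, ‖v t (x t)‖ ≤ C) {s t : ℝ}
    (hs : s ∈ Icc a b) (ht : t ∈ Icc a b) : ‖x t - x s‖ ≤ C * |t - s| := by
  have key : ∀ s t, s ∈ Icc a b → t ∈ Icc a b → s ≤ t → ‖x t - x s‖ ≤ C * |t - s| := by
    intro s t hs ht hst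
    rw [abs_of_nonneg (sub_nonneg.2 hst)]
    have h' := h.mono hs.1 ht.2
    exact norm_image_sub_le_of_norm_deriv_right_le_segment h'.1 h'.2
      (fun r hr => hC r ⟨hs.1.trans hr.1, hr.2.trans_le ht.2⟩) t ⟨hst, le_rfl⟩
  rcases le_total s t with hst | hst
  · exact key s t hs ht hst
  · rw [norm_sub_rev, abs_sub_comm]
    exact key t s ht hs hst

theorem IsRightSolutionOn.lipschitzOnWith {v : ℝ → E → E} {a b C : ℝ} {x : ℝ → E}
    (h : IsRightSolutionOn v a b x) (hC : ∀ t ∈ Ico a b, ‖v t (x t)‖ ≤ C) :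
    LipschitzOnWith C.toNNReal x (Icc a b) := by
  refine LipschitzOnWith.of_dist_le_mul fun s hs t ht => ?_
  rw [dist_eq_norm, Real.dist_eq]
  exact (h.norm_sub_le hC ht hs).trans
    (mul_le_mul_of_nonneg_right (Real.le_coe_toNNReal C) (abs_nonneg _))

/-- A right solution with bounded velocity is a Carathéodory solution. -/
theorem IsRightSolutionOn.isSolutionOn [FiniteDimensional ℝ E] {v : ℝ → E → E} {a b C : ℝ}
    {x : ℝ → E} (h : IsRightSolutionOn v a b x) (hab : a ≤ b)
    (hC : ∀ t ∈ Ico a b, ‖v t (x t)‖ ≤ C) : IsSolutionOn v a b x := by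
  have hL := h.lipschitzOnWith hC
  refine ⟨LipschitzOnWith.absolutelyContinuousOnInterval (K := C.toNNReal)
    (by rwa [uIcc_of_le hab]), ?_⟩
  -- Rademacher: where the two-sided derivative exists, it is the right derivative.
  filter_upwards [hL.ae_differentiableWithinAt_of_mem] with t ht htI
  have h1 : HasDerivAt x (deriv x t) t :=
    ((ht (Ioo_subset_Icc_self htI)).differentiableAt (Icc_mem_nhds htI.1 htI.2)).hasDerivAt
  have h2 := (uniqueDiffWithinAt_Ici t).eq_deriv _ (h.2 t ⟨htI.1.le, htI.2⟩) h1.hasDerivWithinAt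
  rwa [h2]

theorem IsRightSolutionOn.eq_add_integral [CompleteSpace E] {F : E → E} (hF : Continuous F)
    {a b : ℝ} {x : ℝ → E} (h : IsRightSolutionOn (fun _ => F) a b x) {t : ℝ} (ht : t ∈ Icc a b) :
    x t = x a + ∫ s in a..t, F (x s) := by
  have h' := h.mono le_rfl ht.2
  have hc : ContinuousOn (fun s => F (x s)) (uIcc a t) := by
    rw [uIcc_of_le ht.1]; exact hF.comp_continuousOn h'.1
  rw [intervalIntegral.integral_eq_sub_of_hasDeriv_right (f := x)
    (by rw [uIcc_of_le ht.1]; exact h'.1) ?_ hc.intervalIntegrable]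
  · abel
  · rw [min_eq_left ht.1, max_eq_right ht.1]
    exact fun s hs => (h'.2 s ⟨hs.1.le, hs.2⟩).mono Ioi_subset_Ici_self

theorem hasDerivAt_of_eq_add_integral [CompleteSpace E] {F : E → E} (hF : Continuous F)
    {a b : ℝ} {x : ℝ → E} (hx : ContinuousOn x (Icc a b))
    (h : ∀ t ∈ Icc a b, x t = x a + ∫ s in a..t, F (x s)) {t : ℝ} (ht : t ∈ Ioo a b) :
    HasDerivAt x (F (x t)) t := by
  have hc : ContinuousOn (fun s => F (x s)) (Icc a b) := hF.comp_continuousOn hx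
  have h1 : HasDerivAt (fun u => x a + ∫ s in a..u, F (x s)) (F (x t)) t := by
    refine HasDerivAt.const_add _ (intervalIntegral.integral_hasDerivAt_right ?_ ?_ ?_)
    · refine ContinuousOn.intervalIntegrable (hc.mono ?_)
      rw [uIcc_of_le ht.1.le]; exact Icc_subset_Icc le_rfl ht.2.le
    · exact (hc.mono Ioo_subset_Icc_self).stronglyMeasurableAtFilter isOpen_Ioo _ ht
    · exact hc.continuousAt (Icc_mem_nhds ht.1 ht.2)
  refine h1.congr_of_eventuallyEq ?_
  filter_upwards [Icc_mem_nhds ht.1 ht.2] with s hs using h s hs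

/-- The integral form of the equation is the one that survives limits of solutions. -/
theorem isRightSolutionOn_of_eq_add_integral [CompleteSpace E] {F : E → E} (hF : Continuous F)
    {a b : ℝ} {x : ℝ → E} (hx : ContinuousOn x (Icc a b))
    (h : ∀ t ∈ Icc a b, x t = x a + ∫ s in a..t, F (x s)) :
    IsRightSolutionOn (fun _ => F) a b x := by
  refine ⟨hx, fun t ht => ?_⟩
  have hab : a ≤ b := ht.1.trans ht.2.le
  set g : ℝ → E := fun s => F (IccExtend hab ((Icc a b).domRestrict x) s) with hg
  have hgc : Continuous g := hF.comp hx.domRestrict.Icc_extend'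
  have hgx : ∀ s ∈ Icc a b, g s = F (x s) := fun s hs => by
    simp only [hg, IccExtend_of_mem hab _ hs, domRestrict_apply]
  have h1 : HasDerivWithinAt (fun u => x a + ∫ s in a..u, g s) (g t) (Ici t) t :=
    ((hgc.integral_hasStrictDerivAt a t).hasDerivAt.const_add _).hasDerivWithinAt
  rw [hgx t ⟨ht.1, ht.2.le⟩] at h1
  refine h1.congr_of_eqOn_Ico ht.2 fun s hs => ?_
  rw [h s ⟨ht.1.trans hs.1, hs.2.le⟩]
  congr 1
  refine intervalIntegral.integral_congr fun r hr => ?_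
  rw [uIcc_of_le (ht.1.trans hs.1)] at hr
  exact (hgx r ⟨hr.1, hr.2.trans hs.2.le⟩).symm

theorem IsRightSolutionOn.hasDerivAt [CompleteSpace E] {F : E → E} (hF : Continuous F)
    {a b : ℝ} {x : ℝ → E} (h : IsRightSolutionOn (fun _ => F) a b x) {t : ℝ}
    (ht : t ∈ Ioo a b) : HasDerivAt x (F (x t)) t :=
  hasDerivAt_of_eq_add_integral hF h.1 (fun _ hs => h.eq_add_integral hF hs) ht

end RightSolutions

/-! ### Compactness of solution sets and Peano existence -/

section Peano

variable {E : Type*} [NormedAddCommGroup E] [NormedSpace ℝ E]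

/-- Solutions of uniformly bounded autonomous equations whose fields converge uniformly have a
subsequence which converges pointwise to a solution of the limit equation. -/
theorem exists_subseq_tendsto_isRightSolutionOn [FiniteDimensional ℝ E] {F : E → E}
    {Fn : ℕ → E → E} {a b C R : ℝ} {x : ℕ → ℝ → E} (hab : a ≤ b) (hF : Continuous F)
    (hFn : ∀ n, Continuous (Fn n)) (hC : ∀ n y, ‖Fn n y‖ ≤ C)
    (hlim : TendstoUniformly Fn F atTop)
    (hx : ∀ n, IsRightSolutionOn (fun _ => Fn n) a b (x n)) (hR : ∀ n, ‖x n a‖ ≤ R) :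
    ∃ φ : ℕ → ℕ, StrictMono φ ∧ ∃ y, IsRightSolutionOn (fun _ => F) a b y ∧
      ∀ t ∈ Icc a b, Tendsto (fun n => x (φ n) t) atTop (𝓝 (y t)) := by
  have : CompleteSpace E := FiniteDimensional.complete ℝ E
  have : ProperSpace E := FiniteDimensional.proper ℝ E
  have hC0 : 0 ≤ C := (norm_nonneg _).trans (hC 0 0)
  have hLip : ∀ n, LipschitzOnWith C.toNNReal (x n) (Icc a b) := fun n =>
    (hx n).lipschitzOnWith fun t _ => hC n _
  let X : ℕ → BoundedContinuousFunction (Icc a b) E := fun n =>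
    BoundedContinuousFunction.mkOfCompact ⟨(Icc a b).domRestrict (x n), (hx n).1.domRestrict⟩
  have hXapp : ∀ n (t : Icc a b), X n t = x n t := fun n t => rfl
  -- Arzelà–Ascoli: the common velocity bound gives equicontinuity and, with the bound on the
  -- initial states, a common ball.
  have hcomp : IsCompact (closure (range X)) := by
    refine BoundedContinuousFunction.arzela_ascoli (Metric.closedBall 0 (R + C * (b - a)))
      (isCompact_closedBall _ _) _ ?_ ?_
    · rintro _ t ⟨n, rfl⟩
      rw [mem_closedBall_zero_iff, hXapp]
      have h1 := (hx n).norm_sub_le (fun t _ => hC n _) (left_mem_Icc.2 hab) t.2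
      have h2 : |(t : ℝ) - a| ≤ b - a := by
        rw [abs_of_nonneg (sub_nonneg.2 t.2.1)]; linarith [t.2.2]
      have h3 := mul_le_mul_of_nonneg_left h2 hC0
      have h4 : ‖x n t‖ ≤ ‖x n t - x n a‖ + ‖x n a‖ := by
        simpa using norm_add_le (x n t - x n a) (x n a)
      linarith [hR n]
    · refine (LipschitzWith.uniformEquicontinuous _ C.toNNReal ?_).equicontinuous
      rintro ⟨_, n, rfl⟩
      exact LipschitzWith.of_dist_le_mul fun s t => (hLip n).dist_le_mul s s.2 t t.2
  obtain ⟨Y, -, φ, hφ, hY⟩ := hcomp.tendsto_subseq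
    (fun n => subset_closure (mem_range_self n) : ∀ n, X n ∈ closure (range X))
  set y : ℝ → E := IccExtend hab Y with hy
  have hyY : ∀ t (ht : t ∈ Icc a b), y t = Y ⟨t, ht⟩ := fun t ht => IccExtend_of_mem hab _ ht
  have hpt : ∀ t ∈ Icc a b, Tendsto (fun n => x (φ n) t) atTop (𝓝 (y t)) := by
    intro t ht
    rw [hyY t ht]
    exact ((continuous_eval_const (⟨t, ht⟩ : Icc a b)).tendsto Y).comp
      hY
  have hyc : Continuous y := Y.continuous.Icc_extend'
  have hlimφ : TendstoUniformly (fun n => Fn (φ n)) F atTop := fun u hu =>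
    hφ.tendsto_atTop.eventually (hlim u hu)
  refine ⟨φ, hφ, y, isRightSolutionOn_of_eq_add_integral hF hyc.continuousOn fun t ht => ?_, hpt⟩
  have hsub : uIoc a t ⊆ Icc a b := by
    rw [uIoc_of_le ht.1]; exact fun s hs => ⟨hs.1.le, hs.2.trans ht.2⟩
  have hint : Tendsto (fun n => ∫ s in a..t, Fn (φ n) (x (φ n) s)) atTop
      (𝓝 (∫ s in a..t, F (y s))) := by
    refine intervalIntegral.tendsto_integral_filter_of_dominated_convergence (fun _ => C) ?_ ?_ ?_ ?_
    · exact .of_forall fun n => (((hFn _).comp_continuousOn (hx _).1).mono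
        hsub).aestronglyMeasurable measurableSet_uIoc
    · exact .of_forall fun n => .of_forall fun s _ => hC _ _
    · exact intervalIntegrable_const
    · exact .of_forall fun s hs => hlimφ.tendsto_comp hF.continuousAt (hpt s (hsub hs))
  refine tendsto_nhds_unique (hpt t ht) ?_
  refine ((hpt a (left_mem_Icc.2 hab)).add hint).congr fun n => ?_
  exact ((hx (φ n)).eq_add_integral (hFn _) ht).symm

/-- Since the field is bounded everywhere, the Picard–Lindelöf ball can have radius `C * (b - a)`,
large enough for the whole interval. -/
theorem exists_isRightSolutionOn_of_lipschitz [CompleteSpace E] {F : E → E} {K : NNReal}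
    {a b C : ℝ} (hab : a ≤ b) (hF : LipschitzWith K F) (hC : ∀ y, ‖F y‖ ≤ C) (x₀ : E) :
    ∃ x, IsRightSolutionOn (fun _ => F) a b x ∧ x a = x₀ := by
  have hC0 : 0 ≤ C := (norm_nonneg _).trans (hC 0)
  have hpl : IsPicardLindelof (fun _ => F) (tmin := a) (tmax := b) ⟨a, left_mem_Icc.2 hab⟩ x₀
      (C * (b - a)).toNNReal 0 C.toNNReal K := by
    refine IsPicardLindelof.of_time_independent (fun y _ => ?_) hF.lipschitzOnWith ?_
    · rw [Real.coe_toNNReal _ hC0]; exact hC y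
    · rw [Real.coe_toNNReal _ hC0, Real.coe_toNNReal _ (mul_nonneg hC0 (sub_nonneg.2 hab))]
      simp [hab]
  obtain ⟨x, hxa, hx⟩ := hpl.exists_eq_forall_mem_Icc_hasDerivWithinAt₀
  refine ⟨x, ⟨fun t ht => (hx t ht).continuousWithinAt, fun t ht => ?_⟩, hxa⟩
  exact (hx t (Ico_subset_Icc_self ht)).mono_of_mem_nhdsWithin (Icc_mem_nhdsGE_of_mem ht)

/-- **Peano's theorem** for a bounded field which is a uniform limit of bounded Lipschitz fields. -/
theorem exists_isRightSolutionOn_of_approx [FiniteDimensional ℝ E] {F : E → E}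
    {Fn : ℕ → E → E} {a b C : ℝ} (hab : a ≤ b) (hFn : ∀ n, ∃ K, LipschitzWith K (Fn n))
    (hC : ∀ n y, ‖Fn n y‖ ≤ C) (hlim : TendstoUniformly Fn F atTop) (x₀ : E) :
    ∃ x, IsRightSolutionOn (fun _ => F) a b x ∧ x a = x₀ := by
  have : CompleteSpace E := FiniteDimensional.complete ℝ E
  have hFc : ∀ n, Continuous (Fn n) := fun n => (hFn n).choose_spec.continuous
  have hF : Continuous F := hlim.continuous (Frequently.of_forall hFc)
  choose K hK using hFn
  choose x hx hx₀ using fun n => exists_isRightSolutionOn_of_lipschitz hab (hK n) (hC n) x₀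
  obtain ⟨φ, -, y, hy, hlim'⟩ := exists_subseq_tendsto_isRightSolutionOn hab hF hFc hC hlim hx
    (fun n => by rw [hx₀])
  refine ⟨y, hy, tendsto_nhds_unique (hlim' a (left_mem_Icc.2 hab)) ?_⟩
  simp [hx₀]

/-- The values of a function on `[-R, R]`, extended to `ℝ` by constants. -/
def clampedFun (f : ℝ → ℝ) (R r : ℝ) : ℝ := f (max (-R) (min R r))

theorem clampedFun_of_abs_le {f : ℝ → ℝ} {R r : ℝ} (h : |r| ≤ R) : clampedFun f R r = f r := by
  rw [abs_le] at h
  rw [clampedFun, min_eq_right h.2, max_eq_right h.1]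

theorem continuous_clampedFun {f : ℝ → ℝ} (hf : Continuous f) (R : ℝ) :
    Continuous (clampedFun f R) := by
  unfold clampedFun; fun_prop

theorem clamp_mem_Icc {R : ℝ} (hR : 0 ≤ R) (r : ℝ) : max (-R) (min R r) ∈ Icc (-R) R :=
  ⟨le_max_left _ _, max_le (by linarith) (min_le_left _ _)⟩

theorem exists_abs_clampedFun_le {f : ℝ → ℝ} (hf : Continuous f) {R : ℝ} (hR : 0 ≤ R) :
    ∃ C, ∀ r, |clampedFun f R r| ≤ C := by
  obtain ⟨C, hC⟩ := (isCompact_Icc (a := -R) (b := R)).exists_bound_of_continuousOn hf.continuousOn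
  exact ⟨C, fun r => hC _ (clamp_mem_Icc hR r)⟩

theorem clampedFun_nonpos {f : ℝ → ℝ} (hf : ∀ r ≤ 0, f r ≤ 0) {R r : ℝ} (hR : 0 ≤ R)
    (hr : r ≤ 0) : clampedFun f R r ≤ 0 :=
  hf _ (max_le (by linarith) ((min_le_right _ _).trans hr))

theorem clampedFun_nonneg {f : ℝ → ℝ} (hf : ∀ r, 0 ≤ r → 0 ≤ f r) {R r : ℝ} (hR : 0 ≤ R)
    (hr : 0 ≤ r) : 0 ≤ clampedFun f R r :=
  hf _ (le_max_of_le_right (le_min hR hr))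

/-- Weierstrass polynomials are Lipschitz on `[-R, R]`, and clamping the argument makes this global.
-/
theorem exists_lipschitz_tendstoUniformly_clampedFun {f : ℝ → ℝ} (hf : Continuous f) {R : ℝ}
    (hR : 0 ≤ R) :
    ∃ (fn : ℕ → ℝ → ℝ) (C : ℝ), (∀ n, ∃ K, LipschitzWith K (fn n)) ∧ (∀ n r, |fn n r| ≤ C) ∧
      TendstoUniformly fn (clampedFun f R) atTop := by
  obtain ⟨C, hC⟩ := exists_abs_clampedFun_le hf hR
  choose p hp using fun n : ℕ => exists_polynomial_near_of_continuousOn (-R) R f hf.continuousOn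
    (1 / ((n : ℝ) + 1)) Nat.one_div_pos_of_nat
  have hnear : ∀ n r, |clampedFun (p n).eval R r - clampedFun f R r| < 1 / ((n : ℝ) + 1) :=
    fun n r => hp n _ (clamp_mem_Icc hR r)
  refine ⟨fun n => clampedFun (p n).eval R, C + 1, fun n => ?_, fun n r => ?_, ?_⟩
  · have hcd : ContDiff ℝ 1 fun r => (p n).eval r := by
      simpa [Polynomial.coe_aeval_eq_eval] using Polynomial.contDiff_aeval (𝕜 := ℝ) (p n) 1
    obtain ⟨K, hK⟩ := hcd.contDiffOn.exists_lipschitzOnWith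
      (s := Icc (-R) R) (by decide) (convex_Icc _ _) isCompact_Icc
    have hcl : LipschitzWith 1 (fun r : ℝ => max (-R) (min R r)) :=
      (LipschitzWith.id.const_min R).const_max (-R)
    refine ⟨K, LipschitzWith.of_dist_le_mul fun r s => ?_⟩
    refine (hK.dist_le_mul _ (clamp_mem_Icc hR r) _ (clamp_mem_Icc hR s)).trans ?_
    exact mul_le_mul_of_nonneg_left (by simpa using hcl.dist_le_mul r s) K.2
  · have h1 : 1 / ((n : ℝ) + 1) ≤ 1 := by
      rw [div_le_one (by positivity)]; linarith [n.cast_nonneg (α := ℝ)]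
    have h2 := abs_sub_abs_le_abs_sub (clampedFun (p n).eval R r) (clampedFun f R r)
    linarith [hC r, hnear n r]
  · rw [Metric.tendstoUniformly_iff]
    intro ε hε
    filter_upwards [(tendsto_one_div_add_atTop_nhds_zero_nat (𝕜 := ℝ)).eventually_lt_const hε]
      with n hn r
    rw [dist_comm, Real.dist_eq]
    exact (hnear n r).trans hn

end Peano

/-! ### Maximum principle and existence for a network -/

section Network

variable {V : Type*} [Fintype V]

/-- The vector field of the closed loop for a fixed network topology. -/
def networkField (G : WeightedGraph V) (f : ℝ → ℝ) (x : V → ℝ) : V → ℝ :=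
  fun i => f (consensusError G x i)

theorem WeightedGraph.weight_nonneg {V : Type*} (G : WeightedGraph V) (i j : V) :
    0 ≤ G.weight i j := by
  by_cases h : G.graph.Adj i j
  · exact (G.weight_pos i j h).le
  · exact (G.weight_eq_zero i j h).ge

theorem consensusError_nonpos {G : WeightedGraph V} {x : V → ℝ} {i : V}
    (h : ∀ j, G.graph.Adj i j → x j ≤ x i) : consensusError G x i ≤ 0 := by
  refine Finset.sum_nonpos fun j _ => ?_
  by_cases hij : G.graph.Adj i j
  · exact mul_nonpos_of_nonneg_of_nonpos (G.weight_nonneg i j) (sub_nonpos.2 (h j hij))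
  · simp [G.weight_eq_zero i j hij]

theorem eq_of_consensusError_eq_zero {G : WeightedGraph V} {x : V → ℝ} {i : V}
    (h : ∀ j, x j ≤ x i) (h0 : consensusError G x i = 0) {j : V} (hij : G.graph.Adj i j) :
    x j = x i := by
  have h1 := (Finset.sum_eq_zero_iff_of_nonpos fun j _ =>
    mul_nonpos_of_nonneg_of_nonpos (G.weight_nonneg i j) (sub_nonpos.2 (h j))).1 h0 j
    (Finset.mem_univ j)
  rcases mul_eq_zero.1 h1 with h2 | h2
  · exact absurd h2 (G.weight_pos i j hij).ne'
  · linarith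

theorem consensusError_neg (G : WeightedGraph V) (x : V → ℝ) (i : V) :
    consensusError G (-x) i = -consensusError G x i := by
  simp only [consensusError, Pi.neg_apply, ← Finset.sum_neg_distrib]
  exact Finset.sum_congr rfl fun j _ => by ring

theorem consensusError_of_mem_consensusSet (G : WeightedGraph V) {x : V → ℝ}
    (hx : x ∈ consensusSet V) (i : V) : consensusError G x i = 0 :=
  Finset.sum_eq_zero fun j _ => by rw [hx j i, sub_self, mul_zero]

theorem continuous_consensusError (G : WeightedGraph V) (i : V) :
    Continuous fun x => consensusError G x i := by
  unfold consensusError; fun_prop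

theorem continuous_networkField (G : WeightedGraph V) {f : ℝ → ℝ} (hf : Continuous f) :
    Continuous (networkField G f) :=
  continuous_pi fun i => hf.comp (continuous_consensusError G i)

theorem exists_lipschitzWith_consensusError (G : WeightedGraph V) :
    ∃ K, LipschitzWith K (consensusError G) := by
  let L : (V → ℝ) →L[ℝ] (V → ℝ) := ContinuousLinearMap.pi fun i =>
    ∑ j, G.weight i j • ((ContinuousLinearMap.proj j : (V → ℝ) →L[ℝ] ℝ) - ContinuousLinearMap.proj i)
  refine ⟨‖L‖₊, ?_⟩
  convert! L.lipschitz using 1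
  ext x i
  simp [L, consensusError]

theorem exists_lipschitzWith_networkField (G : WeightedGraph V) {f : ℝ → ℝ} {K : NNReal}
    (hf : LipschitzWith K f) : ∃ K', LipschitzWith K' (networkField G f) := by
  obtain ⟨L, hL⟩ := exists_lipschitzWith_consensusError G
  refine ⟨K * L, LipschitzWith.of_dist_le_mul fun x y => ?_⟩
  refine (dist_pi_le_iff (by positivity)).2 fun i => ?_
  refine (hf.dist_le_mul _ _).trans ?_
  rw [NNReal.coe_mul, mul_assoc]
  exact mul_le_mul_of_nonneg_left ((dist_le_pi_dist _ _ i).trans (hL.dist_le_mul x y)) K.2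

theorem exists_abs_consensusError_le (G : WeightedGraph V) (R : ℝ) :
    ∃ B, 0 ≤ B ∧ ∀ x, ‖x‖ ≤ R → ∀ i, |consensusError G x i| ≤ B := by
  obtain ⟨B, hB⟩ := (isCompact_closedBall (0 : V → ℝ) R).exists_bound_of_continuousOn
    (continuous_pi fun i => continuous_consensusError G i).continuousOn
  refine ⟨max B 0, le_max_right _ _, fun x hx i => ?_⟩
  exact (norm_le_pi_norm (consensusError G x) i).trans
    ((hB x (mem_closedBall_zero_iff.2 hx)).trans (le_max_left _ _))

theorem exists_norm_networkField_le {ι : Type*} [Fintype ι] (X : ι → WeightedGraph V) {f : ℝ → ℝ}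
    (hf : Continuous f) (R : ℝ) : ∃ C, ∀ k x, ‖x‖ ≤ R → ‖networkField (X k) f x‖ ≤ C := by
  obtain ⟨C, hC⟩ := (isCompact_closedBall (0 : V → ℝ) R).exists_bound_of_continuousOn
    (continuous_pi fun k => continuous_networkField (X k) hf).continuousOn
  exact ⟨C, fun k x hx => (norm_le_pi_norm (fun k => networkField (X k) f x) k).trans
    (hC x (mem_closedBall_zero_iff.2 hx))⟩

/-- Maximum principle: in a set of agents without neighbours outside, the maximal state does not
increase. -/
theorem IsRightSolutionOn.forall_le {G : ℝ → WeightedGraph V} {f : ℝ → ℝ}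
    (hf : ∀ r ≤ 0, f r ≤ 0) {a b : ℝ} {x : ℝ → V → ℝ}
    (hx : IsRightSolutionOn (fun t => networkField (G t) f) a b x) {K : Set V}
    (hK : ∀ t ∈ Ico a b, ∀ i ∈ K, ∀ j, (G t).graph.Adj i j → j ∈ K) {c : ℝ}
    (h0 : ∀ i ∈ K, x a i ≤ c) : ∀ t ∈ Icc a b, ∀ i ∈ K, x t i ≤ c := by
  -- The barrier rises with slope `ε`, strictly faster than any agent touching it, whose neighbours
  -- all lie in `K` and so below the barrier. Then `ε → 0`.
  have key : ∀ ε > 0, Icc a b ⊆ {t | ∀ i ∈ K, x t i ≤ c + ε * (t - a)} := by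
    intro ε hε
    refine IsClosed.Icc_subset_of_forall_mem_nhdsWithin ?_ (by simpa using h0) ?_
    · have h1 : ContinuousOn (fun t => fun i => x t i - (c + ε * (t - a))) (Icc a b) := by
        refine continuousOn_pi.2 fun i => ContinuousOn.sub ?_ (by fun_prop)
        exact continuousOn_pi.1 hx.1 i
      have h2 : IsClosed {y : V → ℝ | ∀ i ∈ K, y i ≤ 0} := by
        simp only [ofPred_forall]
        exact isClosed_biInter fun i _ => isClosed_le (continuous_apply i) continuous_const
      convert! h1.preimage_isClosed_of_isClosed isClosed_Icc h2 using 1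
      ext t
      simp [and_comm]
    · rintro t ⟨htS, ht⟩
      change ∀ᶠ r in 𝓝[>] t, ∀ i ∈ K, x r i ≤ c + ε * (r - a)
      refine eventually_all.2 fun i => eventually_imp_distrib_left.2 fun hi => ?_
      have hd : HasDerivWithinAt (fun r => x r i) (f (consensusError (G t) (x t) i)) (Ioi t) t :=
        (hasDerivWithinAt_pi.1 (hx.2 t ht) i).mono Ioi_subset_Ici_self
      rcases (htS i hi).lt_or_eq with hlt | heq
      · have h1 : ContinuousWithinAt (fun r => c + ε * (r - a)) (Ioi t) t := by fun_prop
        exact (hd.continuousWithinAt.eventually_lt h1 hlt).mono fun r hr => hr.le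
      · have h1 : f (consensusError (G t) (x t) i) ≤ 0 :=
          hf _ (consensusError_nonpos fun j hij => heq ▸ htS j (hK t ht i hi j hij))
        filter_upwards [hd.limsup_slope_le' (by simp) (h1.trans_lt hε), self_mem_nhdsWithin]
          with r hr htr
        have htr' : 0 < r - t := sub_pos.2 htr
        rw [slope_def_field, div_lt_iff₀ htr'] at hr
        rw [heq] at hr
        linarith
  intro t ht i hi
  have h1 : Tendsto (fun ε : ℝ => c + ε * (t - a)) (𝓝[>] 0) (𝓝 c) := by
    have : Continuous fun ε : ℝ => c + ε * (t - a) := by fun_prop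
    simpa using (this.tendsto 0).mono_left nhdsWithin_le_nhds
  refine ge_of_tendsto h1 ?_
  filter_upwards [self_mem_nhdsWithin] with ε hε using key ε hε ht i hi

/-- Reflection preserves the sign conditions on `f` and so turns upper bounds into lower ones. -/
theorem IsRightSolutionOn.networkField_neg {G : ℝ → WeightedGraph V} {f : ℝ → ℝ} {a b : ℝ}
    {x : ℝ → V → ℝ} (hx : IsRightSolutionOn (fun t => networkField (G t) f) a b x) :
    IsRightSolutionOn (fun t => networkField (G t) fun r => -f (-r)) a b (fun t => -x t) := by
  refine ⟨hx.1.neg, fun t ht => ?_⟩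
  convert! (hx.2 t ht).neg using 1
  ext i
  simp [networkField, consensusError_neg]

theorem IsRightSolutionOn.forall_mem_Icc {G : ℝ → WeightedGraph V} {f : ℝ → ℝ}
    (hf : ∀ r ≤ 0, f r ≤ 0) (hf' : ∀ r, 0 ≤ r → 0 ≤ f r) {a b : ℝ} {x : ℝ → V → ℝ}
    (hx : IsRightSolutionOn (fun t => networkField (G t) f) a b x) {lo hi : ℝ}
    (h0 : ∀ i, x a i ∈ Icc lo hi) : ∀ t ∈ Icc a b, ∀ i, x t i ∈ Icc lo hi := by
  intro t ht i
  have h1 := hx.forall_le hf (K := univ) (fun _ _ _ _ _ _ => mem_univ _)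
    (fun i _ => (h0 i).2) t ht i (mem_univ i)
  have h2 := hx.networkField_neg.forall_le (fun r hr => neg_nonpos.2 (hf' (-r) (neg_nonneg.2 hr)))
    (K := univ) (fun _ _ _ _ _ _ => mem_univ _)
    (fun i _ => neg_le_neg (h0 i).1) t ht i (mem_univ i)
  exact ⟨neg_le_neg_iff.1 h2, h1⟩

/-- In the sup norm, a ball around a consensus state is a cube with the same interval for every
agent, which the maximum principle makes invariant. -/
theorem IsRightSolutionOn.dist_le {G : ℝ → WeightedGraph V} {f : ℝ → ℝ}
    (hf : ∀ r ≤ 0, f r ≤ 0) (hf' : ∀ r, 0 ≤ r → 0 ≤ f r) {a b : ℝ} {x : ℝ → V → ℝ}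
    (hx : IsRightSolutionOn (fun t => networkField (G t) f) a b x) {c : V → ℝ}
    (hc : c ∈ consensusSet V) {t : ℝ} (ht : t ∈ Icc a b) : dist (x t) c ≤ dist (x a) c := by
  refine (dist_pi_le_iff dist_nonneg).2 fun i => ?_
  have h0 : ∀ j, x a j ∈ Icc (c i - dist (x a) c) (c i + dist (x a) c) := fun j => by
    rw [← Real.closedBall_eq_Icc, hc i j]
    exact dist_le_pi_dist _ _ j
  have h1 := hx.forall_mem_Icc hf hf' h0 t ht i
  rwa [← Real.closedBall_eq_Icc] at h1

theorem zero_mem_consensusSet {V : Type*} : (0 : V → ℝ) ∈ consensusSet V := fun _ _ => rfl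

theorem IsRightSolutionOn.norm_le {G : ℝ → WeightedGraph V} {f : ℝ → ℝ}
    (hf : ∀ r ≤ 0, f r ≤ 0) (hf' : ∀ r, 0 ≤ r → 0 ≤ f r) {a b : ℝ} {x : ℝ → V → ℝ}
    (hx : IsRightSolutionOn (fun t => networkField (G t) f) a b x) {t : ℝ} (ht : t ∈ Icc a b) :
    ‖x t‖ ≤ ‖x a‖ := by
  simpa using hx.dist_le hf hf' zero_mem_consensusSet ht

theorem norm_networkField_le {G : WeightedGraph V} {f : ℝ → ℝ} {C : ℝ} (hC : ∀ r, |f r| ≤ C)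
    (x : V → ℝ) : ‖networkField G f x‖ ≤ C :=
  (pi_norm_le_iff_of_nonneg ((abs_nonneg _).trans (hC 0))).2 fun _ => hC _

theorem exists_isRightSolutionOn_networkField (G : WeightedGraph V) {f : ℝ → ℝ}
    (hfc : Continuous f) (hf : ∀ r ≤ 0, f r ≤ 0) (hf' : ∀ r, 0 ≤ r → 0 ≤ f r) {a b : ℝ}
    (hab : a ≤ b) (x₀ : V → ℝ) :
    ∃ x, IsRightSolutionOn (fun _ => networkField G f) a b x ∧ x a = x₀ := by
  obtain ⟨B, hB0, hB⟩ := exists_abs_consensusError_le G ‖x₀‖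
  obtain ⟨fn, C, hfnL, hfnC, hfn⟩ := exists_lipschitz_tendstoUniformly_clampedFun hfc hB0
  obtain ⟨x, hx, hx₀⟩ := exists_isRightSolutionOn_of_approx (F := networkField G (clampedFun f B))
    (Fn := fun n => networkField G (fn n)) (C := C) hab
    (fun n => exists_lipschitzWith_networkField G (hfnL n).choose_spec)
    (fun n y => norm_networkField_le (hfnC n) y) (by
      rw [Metric.tendstoUniformly_iff] at hfn ⊢
      intro ε hε
      filter_upwards [hfn ε hε] with n hn y
      exact (dist_pi_lt_iff hε).2 fun i => hn _) x₀
  -- Clamping keeps the signs of `f`, so the norm bound holds for `x` too and its consensus errors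
  -- never exceed `B`: the clamp is never felt.
  refine ⟨x, hx.congr_field fun t ht => ?_, hx₀⟩
  have h1 := hx.norm_le (G := fun _ => G) (fun r hr => clampedFun_nonpos hf hB0 hr)
    (fun r hr => clampedFun_nonneg hf' hB0 hr) (Ico_subset_Icc_self ht)
  rw [hx₀] at h1
  exact funext fun i => clampedFun_of_abs_le (hB _ h1 i)

end Network

/-! ### The sign of `f` from scalar stability -/

section Scalar

theorem IsGlobalSolution.isRightSolutionOn {E : Type*} [NormedAddCommGroup E] [NormedSpace ℝ E]
    [CompleteSpace E] {v : ℝ → E → E} {t₀ : ℝ} {x : ℝ → E} (h : IsGlobalSolution v t₀ x)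
    (hv : ∀ t, t₀ ≤ t → ∃ F : E → E, Continuous F ∧ ∀ᶠ s in 𝓝[≥] t, v s = F) (b : ℝ) :
    IsRightSolutionOn v t₀ b x :=
  have hb : t₀ < max (t₀ + 1) b := lt_max_of_lt_left (lt_add_one t₀)
  ((h _ hb).isRightSolutionOn hb.le fun t ht => hv t ht.1).mono le_rfl (le_max_right _ _)

theorem isGlobalSolution_const {E : Type*} [NormedAddCommGroup E] [NormedSpace ℝ E]
    {v : ℝ → E → E} {t₀ : ℝ} {a : E} (h : ∀ t, v t a = 0) :
    IsGlobalSolution v t₀ (fun _ => a) := fun T _ =>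
  ⟨(LipschitzOnWith.absolutelyContinuousOnInterval (K := 0)
    (LipschitzWith.const a).lipschitzOnWith), .of_forall fun t _ => by
      rw [h t]; exact hasDerivAt_const t a⟩

/-- A right solution which starts with a state that the field pushes upwards stays above it. -/
theorem IsRightSolutionOn.le_of_pos {F : ℝ → ℝ} {a b : ℝ} {y : ℝ → ℝ}
    (hy : IsRightSolutionOn (fun _ => F) a b y) (hF : 0 < F (y a)) :
    ∀ t ∈ Icc a b, y a ≤ y t := by
  refine IsClosed.Icc_subset_of_forall_mem_nhdsWithin (s := {t | y a ≤ y t}) ?_ (le_refl (y a)) ?_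
  · convert! hy.1.preimage_isClosed_of_isClosed isClosed_Icc (isClosed_Ici (a := y a)) using 1
    ext t
    simp [and_comm]
  · rintro t ⟨hta, ht⟩
    have hd := (hy.2 t ht).mono Ioi_subset_Ici_self
    rcases (show y a ≤ y t from hta).lt_or_eq with h | h
    · exact (continuousWithinAt_const.eventually_lt hd.continuousWithinAt h).mono fun r hr => hr.le
    · rw [h] at hF
      have h1 := hd.neg.limsup_slope_le' (by simp) (neg_neg_of_pos hF)
      filter_upwards [h1, self_mem_nhdsWithin] with r hr htr
      have htr' : 0 < r - t := sub_pos.2 htr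
      rw [slope_def_field, div_lt_iff₀ htr'] at hr
      change y a ≤ y r
      simp only [Pi.neg_apply] at hr
      linarith

variable {f : ℝ → ℝ}

theorem IsGloballyAsymptoticallyStable.apply_zero
    (h : IsGloballyAsymptoticallyStable (fun _ x : ℝ => -f x) 0 {0}) : f 0 = 0 := by
  have h1 := (h.equilibrium 0 rfl 1 one_pos).2
  -- The equation holds only a.e., but `(0, 1)` has positive measure.
  obtain ⟨t, ht, ht'⟩ : ∃ t, t ∈ Ioo (0 : ℝ) 1 ∧ HasDerivAt (fun _ : ℝ => (0 : ℝ)) (-f 0) t := by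
    by_contra! hne
    have h2 : ∀ᵐ t : ℝ, t ∉ Ioo (0 : ℝ) 1 := by
      filter_upwards [h1] with t ht htI using hne t htI (ht htI)
    have h3 : volume (Ioo (0 : ℝ) 1) = 0 := measure_eq_zero_iff_ae_notMem.2 h2
    simp at h3
  exact neg_eq_zero.1 (ht'.unique (hasDerivAt_const t (0 : ℝ)))

/-- If `f a < 0`, a solution from `a` never falls below `a`; if `f a = 0`, it may rest there. Either
contradicts attractivity. -/
theorem IsGloballyAsymptoticallyStable.apply_pos (hf : Continuous f)
    (h : IsGloballyAsymptoticallyStable (fun _ x : ℝ => -f x) 0 {0}) {a : ℝ} (ha : 0 < a) :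
    0 < f a := by
  by_contra! hfa
  rcases hfa.lt_or_eq with hlt | heq
  · obtain ⟨y, hy, hya⟩ := h.exists_solution a
    obtain ⟨_, rfl, hlim⟩ := h.attractive y hy
    have hy' := hy.isRightSolutionOn fun t _ => ⟨fun x => -f x, hf.neg, .of_forall fun _ => rfl⟩
    have h1 : a ≤ 0 := by
      refine ge_of_tendsto hlim ?_
      filter_upwards [eventually_ge_atTop 0] with t ht
      have := (hy' t).le_of_pos (F := fun x => -f x) (by rw [hya]; linarith) t ⟨ht, le_rfl⟩
      rwa [hya] at this
    linarith
  · obtain ⟨_, rfl, hlim⟩ := h.attractive (fun _ => a) (isGlobalSolution_const fun _ => by simp [heq])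
    exact ha.ne' (tendsto_nhds_unique tendsto_const_nhds hlim)

theorem IsGloballyAsymptoticallyStable.apply_neg (hf : Continuous f)
    (h : IsGloballyAsymptoticallyStable (fun _ x : ℝ => -f x) 0 {0}) {a : ℝ} (ha : a < 0) :
    f a < 0 := by
  by_contra! hfa
  rcases hfa.lt_or_eq with hlt | heq
  · obtain ⟨y, hy, hya⟩ := h.exists_solution a
    obtain ⟨_, rfl, hlim⟩ := h.attractive y hy
    have hy' := hy.isRightSolutionOn fun t _ => ⟨fun x => -f x, hf.neg, .of_forall fun _ => rfl⟩
    have h1 : 0 ≤ a := by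
      refine le_of_tendsto hlim ?_
      filter_upwards [eventually_ge_atTop 0] with t ht
      have hneg : IsRightSolutionOn (fun _ x => f (-x)) 0 t (fun s => -y s) := by
        refine ⟨(hy' t).1.neg, fun s hs => ?_⟩
        simpa using ((hy' t).2 s hs).fun_neg
      have := hneg.le_of_pos (F := fun x => f (-x)) (by simpa [hya] using hlt) t ⟨ht, le_rfl⟩
      rw [hya] at this
      linarith
    linarith
  · obtain ⟨_, rfl, hlim⟩ := h.attractive (fun _ => a)
      (isGlobalSolution_const fun _ => by simp [← heq])
    exact ha.ne (tendsto_nhds_unique tendsto_const_nhds hlim)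

end Scalar

/-! ### Stretches of constant topology -/

section Switching

variable {m : ℕ} {σ : ℝ → Fin m} {t₀ : ℝ}

theorem IsSwitchingSignal.eq_of_forall_not_isSwitchingTime (hσ : IsSwitchingSignal σ t₀) {s e : ℝ}
    (hs : t₀ ≤ s) (h : ∀ t ∈ Ioo s e, ¬ IsSwitchingTime σ t₀ t) : ∀ t ∈ Ico s e, σ t = σ s := by
  intro t ht
  have hc : ContinuousOn σ (Ico s e) := by
    intro r hr
    rcases hr.1.eq_or_lt with rfl | hlt
    · refine (tendsto_const_nhds (x := σ s)).congr' ?_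
      filter_upwards [nhdsWithin_mono s Ico_subset_Ici_self (hσ.1 s hs)] with q hq using hq.symm
    · have h1 : ∀ᶠ q in 𝓝 r, σ q = σ r := by
        by_contra hne
        exact h r ⟨hlt, hr.2⟩ ⟨hs.trans_lt hlt, hne⟩
      refine ((tendsto_const_nhds (x := σ r)).congr' ?_).mono_left nhdsWithin_le_nhds
      filter_upwards [h1] with q hq using hq.symm
  exact isPreconnected_Ico.constant hc ht ⟨le_rfl, ht.1.trans_lt ht.2⟩

/-- A window which is shorter than the dwell time contains at most one switching time `w`, and
the signal stays constant for the same length of time after `w`. -/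
theorem IsSwitchingSignal.exists_dwell (hσ : IsSwitchingSignal σ t₀) :
    ∃ d > 0, (∀ T, t₀ ≤ T → ∃ w ∈ Icc T (T + d), (∀ t ∈ Ico T w, σ t = σ T) ∧
        ∀ t ∈ Ico w (w + d), σ t = σ w) ∧
      ∀ s, t₀ ≤ s → (∀ t ∈ Ico s (s + d), σ t = σ s) →
        ∃ w ∈ Icc (s + d) (s + 2 * d), (∀ t ∈ Ico s w, σ t = σ s) ∧
          ∀ t ∈ Ico w (w + d), σ t = σ w := by
  obtain ⟨τmin, hτ, hdw⟩ := hσ.2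
  have hgap : ∀ w w', IsSwitchingTime σ t₀ w → IsSwitchingTime σ t₀ w' → w ≠ w' →
      τmin ≤ |w - w'| := by
    intro w w' hw hw' hne
    rcases hne.lt_or_gt with h | h
    · rw [abs_sub_comm]; exact (hdw w w' hw hw' h).trans (le_abs_self _)
    · exact (hdw w' w hw' hw h).trans (le_abs_self _)
  have hafter : ∀ w, IsSwitchingTime σ t₀ w → ∀ t ∈ Ico w (w + τmin / 2), σ t = σ w := by
    intro w hw
    refine hσ.eq_of_forall_not_isSwitchingTime hw.1.le fun t ht ht' => ?_
    have := hdw w t hw ht' ht.1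
    linarith [ht.2]
  have hbefore : ∀ s w, t₀ ≤ s → IsSwitchingTime σ t₀ w → w < s + τmin → ∀ t ∈ Ico s w,
      σ t = σ s := by
    intro s w hs hw hws
    refine hσ.eq_of_forall_not_isSwitchingTime hs fun t ht ht' => ?_
    have := hdw t w ht' hw ht.2
    linarith [ht.1]
  -- With `d = τmin / 2`, even an open window of length `2 * d` contains at most one switching time.
  refine ⟨τmin / 2, by positivity, fun T hT => ?_, fun s hs hgood => ?_⟩
  · by_cases h : ∃ w ∈ Ioo T (T + τmin / 2), IsSwitchingTime σ t₀ w
    · obtain ⟨w, hw, hsw⟩ := h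
      exact ⟨w, Ioo_subset_Icc_self hw, hbefore T w hT hsw (by linarith [hw.2]), hafter w hsw⟩
    · push Not at h
      refine ⟨T, ⟨le_rfl, by linarith⟩, by simp, ?_⟩
      exact hσ.eq_of_forall_not_isSwitchingTime hT h
  · by_cases h : ∃ w ∈ Ioo s (s + 2 * (τmin / 2)), IsSwitchingTime σ t₀ w
    · obtain ⟨w, hw, hsw⟩ := h
      refine ⟨w, ⟨?_, hw.2.le⟩, hbefore s w hs hsw (by linarith [hw.2]), hafter w hsw⟩
      -- The signal is constant on `[s, s + d)`, so no switch can occur inside.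
      by_contra! hlt
      refine hsw.2 ?_
      filter_upwards [Ioo_mem_nhds hw.1 hlt] with t ht
      rw [hgood t (Ioo_subset_Ico_self ht), hgood w ⟨hw.1.le, hlt⟩]
    · push Not at h
      have hall := hσ.eq_of_forall_not_isSwitchingTime hs h
      refine ⟨s + τmin / 2, ⟨le_rfl, by linarith⟩,
        fun t ht => hall t ⟨ht.1, by linarith [ht.2]⟩, fun t ht => ?_⟩
      rw [hall t ⟨by linarith [ht.1], by linarith [ht.2]⟩,
        hall (s + τmin / 2) ⟨by linarith, by linarith⟩]

end Switching

/-! ### Global existence and extension for the switched system -/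

section ClosedLoop

variable {V : Type*} [Fintype V] {m : ℕ} {X : Fin m → WeightedGraph V} {σ : ℝ → Fin m} {t₀ : ℝ}
  {f : ℝ → ℝ}

theorem closedLoop_eq_networkField :
    closedLoop X σ f = fun t => networkField (X (σ t)) f := rfl

theorem IsGlobalSolution.isRightSolutionOn_closedLoop {x : ℝ → V → ℝ}
    (hσ : IsSwitchingSignal σ t₀) (hfc : Continuous f)
    (hx : IsGlobalSolution (closedLoop X σ f) t₀ x) (b : ℝ) :
    IsRightSolutionOn (closedLoop X σ f) t₀ b x :=
  hx.isRightSolutionOn (fun t ht => ⟨networkField (X (σ t)) f, continuous_networkField _ hfc,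
    (hσ.1 t ht).mono fun s hs => by rw [closedLoop_eq_networkField]; simp only [hs]⟩) b

theorem isGlobalSolution_closedLoop {x : ℝ → V → ℝ} (hfc : Continuous f)
    (hf : ∀ r ≤ 0, f r ≤ 0) (hf' : ∀ r, 0 ≤ r → 0 ≤ f r)
    (hx : ∀ b, IsRightSolutionOn (closedLoop X σ f) t₀ b x) :
    IsGlobalSolution (closedLoop X σ f) t₀ x := by
  obtain ⟨C, hC⟩ := exists_norm_networkField_le X hfc ‖x t₀‖
  intro T hT
  exact (hx T).isSolutionOn hT.le fun t ht =>
    hC _ _ (IsRightSolutionOn.norm_le hf hf' (hx T) (Ico_subset_Icc_self ht))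

theorem exists_forall_isRightSolutionOn_closedLoop (hσ : IsSwitchingSignal σ t₀)
    (hfc : Continuous f) (hf : ∀ r ≤ 0, f r ≤ 0) (hf' : ∀ r, 0 ≤ r → 0 ≤ f r) {T : ℝ}
    (hT : t₀ ≤ T) (x₀ : V → ℝ) :
    ∃ x, (∀ b, IsRightSolutionOn (closedLoop X σ f) T b x) ∧ x T = x₀ := by
  obtain ⟨d, hd, hdw, -⟩ := hσ.exists_dwell
  refine exists_forall_isRightSolutionOn hd (fun T hT x₀ => ?_) hT x₀
  obtain ⟨w, hw, hw1, hw2⟩ := hdw T hT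
  obtain ⟨x, hx, hx₀⟩ := exists_isRightSolutionOn_networkField (X (σ T)) hfc hf hf' hw.1 x₀
  obtain ⟨y, hy, hy₀⟩ := exists_isRightSolutionOn_networkField (X (σ w)) hfc hf hf' hw.2 (x w)
  have hx' : IsRightSolutionOn (closedLoop X σ f) T w x := hx.congr_field fun t ht => by
    rw [closedLoop_eq_networkField]; simp only [hw1 t ht]
  have hy' : IsRightSolutionOn (closedLoop X σ f) w (T + d) y := hy.congr_field fun t ht => by
    rw [closedLoop_eq_networkField]
    simp only [hw2 t ⟨ht.1, by linarith [ht.2, hw.1]⟩]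
  obtain ⟨z, hzx, -, hz⟩ := hx'.concat hw.1 hy₀.symm
  exact ⟨z, hz _ hw.2 hy', (hzx hw.1).trans hx₀⟩

/-- Bounded velocity makes the solution Lipschitz up to `T`, so it has a limit there from which it
can be restarted. -/
theorem exists_isGlobalSolution_eqOn_Ico (hσ : IsSwitchingSignal σ t₀)
    (hfc : Continuous f) (hf : ∀ r ≤ 0, f r ≤ 0) (hf' : ∀ r, 0 ≤ r → 0 ≤ f r) {T : ℝ}
    (hT : t₀ < T) {x : ℝ → V → ℝ}
    (hx : ∀ s ∈ Ioo t₀ T, IsSolutionOn (closedLoop X σ f) t₀ s x) :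
    ∃ y, IsGlobalSolution (closedLoop X σ f) t₀ y ∧ EqOn y x (Ico t₀ T) := by
  have hx' : ∀ s ∈ Ioo t₀ T, IsRightSolutionOn (closedLoop X σ f) t₀ s x := fun s hs =>
    (hx s hs).isRightSolutionOn hs.1.le fun t ht =>
      ⟨networkField (X (σ t)) f, continuous_networkField _ hfc,
        (hσ.1 t ht.1).mono fun s hs => by rw [closedLoop_eq_networkField]; simp only [hs]⟩
  obtain ⟨C, hC⟩ := exists_norm_networkField_le X hfc ‖x t₀‖
  have hLip : LipschitzOnWith C.toNNReal x (Ico t₀ T) := by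
    refine LipschitzOnWith.of_dist_le_mul fun s hs t ht => ?_
    obtain ⟨q, hq, hqT⟩ := exists_between (max_lt hs.2 ht.2)
    have hsq : s < q := (le_max_left _ _).trans_lt hq
    have htq : t < q := (le_max_right _ _).trans_lt hq
    have hq' := hx' q ⟨hs.1.trans_lt hsq, hqT⟩
    refine (hq'.lipschitzOnWith (C := C) fun r hr => ?_).dist_le_mul s ⟨hs.1, hsq.le⟩ t
      ⟨ht.1, htq.le⟩
    exact hC _ _ (IsRightSolutionOn.norm_le hf hf' hq' (Ico_subset_Icc_self hr))
  obtain ⟨g, hg, hgx⟩ := hLip.extend_pi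
  have hg' : IsRightSolutionOn (closedLoop X σ f) t₀ T g := by
    refine ⟨hg.continuous.continuousOn, fun t ht => ?_⟩
    obtain ⟨q, hq, hqT⟩ := exists_between ht.2
    rw [← hgx ht]
    exact ((hx' q ⟨ht.1.trans_lt hq, hqT⟩).2 t ⟨ht.1, hq⟩).congr_of_eqOn_Ico ht.2
      fun s hs => (hgx ⟨ht.1.trans hs.1, hs.2⟩).symm
  obtain ⟨y, hy, hy₀⟩ := exists_forall_isRightSolutionOn_closedLoop (X := X) hσ hfc hf hf' hT.le
    (g T)
  obtain ⟨z, hzg, -, hz⟩ := hg'.concat hT.le hy₀.symm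
  refine ⟨z, isGlobalSolution_closedLoop hfc hf hf' fun b => ?_,
    fun t ht => (hzg ht.2.le).trans (hgx ht).symm⟩
  exact (hz _ (le_max_left T b) (hy _)).mono le_rfl (le_max_right T b)

end ClosedLoop

/-! ### Strong maximum principle with a uniform margin -/

section Drop

variable {V : Type*} [Fintype V] {f : ℝ → ℝ}

theorem networkField_clampedFun {G : WeightedGraph V} {B : ℝ} {x : V → ℝ}
    (h : ∀ i, |consensusError G x i| ≤ B) :
    networkField G (clampedFun f B) x = networkField G f x :=
  funext fun i => clampedFun_of_abs_le (h i)

/-- Strong maximum principle: an agent which is connected to one that ends at the initial maximum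
of the network starts there. -/
theorem IsRightSolutionOn.le_of_reachable {G : WeightedGraph V} (hfc : Continuous f)
    (hf : ∀ r ≤ 0, f r ≤ 0) (hf0 : ∀ r, f r = 0 → r = 0) {d c : ℝ} (hd : 0 < d) {y : ℝ → V → ℝ}
    (hy : IsRightSolutionOn (fun _ => networkField G f) 0 d y) (h0 : ∀ k, y 0 k ≤ c) {i j : V}
    (hij : G.graph.Reachable i j) (hj : c ≤ y d j) : c ≤ y 0 i := by
  have hle : ∀ t ∈ Icc 0 d, ∀ k, y t k ≤ c := fun t ht k =>
    IsRightSolutionOn.forall_le (G := fun _ => G) hf hy (K := univ) (fun _ _ _ _ _ _ => mem_univ _)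
      (fun k _ => h0 k) t ht k (mem_univ k)
  -- If the whole component of `j` were below `c` at time `t`, the maximum principle on that
  -- component would keep `j` below `c` until `d`.
  have hexists : ∀ t ∈ Ioo 0 d, ∃ l, G.graph.Reachable j l ∧ y t l = c := by
    intro t ht
    by_contra! hne
    have hlt : ∀ᶠ q in 𝓝[<] c, ∀ l, G.graph.Reachable j l → y t l ≤ q := by
      refine eventually_all.2 fun l => eventually_imp_distrib_left.2 fun hl => ?_
      have h1 : y t l < c := lt_of_le_of_ne (hle t (Ioo_subset_Icc_self ht) l) (hne l hl)
      filter_upwards [Ioo_mem_nhdsLT h1] with q hq using hq.1.le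
    obtain ⟨q, hq, hqc⟩ := (hlt.and self_mem_nhdsWithin).exists
    have h2 := IsRightSolutionOn.forall_le (G := fun _ => G) hf (hy.mono ht.1.le le_rfl)
      (K := {l | G.graph.Reachable j l}) (fun _ _ k hk l hkl => hk.trans hkl.reachable)
      (fun l hl => hq l hl) d ⟨ht.2.le, le_rfl⟩ j (SimpleGraph.Reachable.refl j)
    have h3 : q < c := hqc
    linarith
  -- An agent at `c` is at a maximum in time, so its velocity and hence its consensus error vanish;
  -- being also maximal in the network, it has all neighbours at `c`.
  have hadj : ∀ t ∈ Ioo 0 d, ∀ k l, G.graph.Adj k l → y t k = c → y t l = c := by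
    intro t ht k l hkl hk
    have h1 : HasDerivAt (fun s => y s k) (f (consensusError G (y t) k)) t :=
      hasDerivAt_pi.1 (hy.hasDerivAt (continuous_networkField G hfc) ht) k
    have h2 : IsLocalMax (fun s => y s k) t := by
      filter_upwards [Icc_mem_nhds ht.1 ht.2] with s hs
      rw [hk]; exact hle s hs k
    have h3 := hf0 _ (h2.hasDerivAt_eq_zero h1)
    rw [eq_of_consensusError_eq_zero (fun l => hk ▸ hle t (Ioo_subset_Icc_self ht) l) h3 hkl, hk]
  have hreach : ∀ t ∈ Ioo 0 d, ∀ k l, G.graph.Reachable k l → y t k = c → y t l = c := by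
    rintro t ht k l ⟨p⟩ hk
    induction p with
    | nil => exact hk
    | cons h _ ih => exact ih (hadj t ht _ _ h hk)
  have hi : ∀ t ∈ Ioo 0 d, y t i = c := fun t ht => by
    obtain ⟨l, hl, hlc⟩ := hexists t ht
    exact hreach t ht l i (hij.trans hl).symm hlc
  have hlim : Tendsto (fun t => y t i) (𝓝[>] 0) (𝓝 (y 0 i)) :=
    ((hasDerivWithinAt_pi.1 (hy.2 0 ⟨le_rfl, hd⟩) i).continuousWithinAt).mono Ioi_subset_Ici_self
  refine ge_of_tendsto hlim ?_
  filter_upwards [Ioo_mem_nhdsGT hd] with t ht using (hi t ht).ge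

/-- An agent which is connected to one that starts well below `c` ends below `c`, uniformly over
all bounded solutions which start not far above `c`. -/
theorem eventually_le_sub_of_reachable (G : WeightedGraph V) (hfc : Continuous f)
    (hf : ∀ r ≤ 0, f r ≤ 0) (hf' : ∀ r, 0 ≤ r → 0 ≤ f r) (hf0 : ∀ r, f r = 0 → r = 0)
    {d η : ℝ} (hd : 0 < d) (hη : 0 < η) (R c : ℝ) {i j : V} (hij : G.graph.Reachable i j) :
    ∀ᶠ δ in 𝓝[>] (0 : ℝ), ∀ y : ℝ → V → ℝ,
      IsRightSolutionOn (fun _ => networkField G f) 0 d y → ‖y 0‖ ≤ R →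
      (∀ k, y 0 k ≤ c + δ) → y 0 i ≤ c - η → y d j ≤ c - δ := by
  by_contra hne
  obtain ⟨δ, hδ, hδ'⟩ := exists_seq_forall_of_frequently (not_eventually.1 hne)
  push Not at hδ'
  -- Counterexamples with `δ n → 0` subconverge to a solution that contradicts the strong maximum
  -- principle. Clamping supplies the bounded field needed for compactness.
  choose y hy hyR hyc hyi hyj using hδ'
  obtain ⟨B, hB0, hB⟩ := exists_abs_consensusError_le G R
  obtain ⟨C, hC⟩ := exists_abs_clampedFun_le hfc hB0
  have hcl : ∀ z : V → ℝ, ‖z‖ ≤ R → networkField G (clampedFun f B) z = networkField G f z :=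
    fun z hz => networkField_clampedFun (hB z hz)
  have hcont : Continuous (networkField G (clampedFun f B)) :=
    continuous_networkField G (continuous_clampedFun hfc B)
  obtain ⟨φ, hφ, z, hz, hlim⟩ := exists_subseq_tendsto_isRightSolutionOn
    (F := networkField G (clampedFun f B)) (Fn := fun _ => networkField G (clampedFun f B))
    hd.le hcont (fun _ => hcont) (fun _ => norm_networkField_le hC)
    (fun _ hu => .of_forall fun _ _ => refl_mem_uniformity hu)
    (fun n => (hy n).congr_field fun t ht => (hcl _ ((IsRightSolutionOn.norm_le (G := fun _ => G)
      hf hf' (hy n) (Ico_subset_Icc_self ht)).trans (hyR n))).symm) hyR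
  have hz0 := hlim 0 (left_mem_Icc.2 hd.le)
  have hzd := hlim d (right_mem_Icc.2 hd.le)
  have hzR : ‖z 0‖ ≤ R := le_of_tendsto' hz0.norm fun n => hyR _
  have hz' : IsRightSolutionOn (fun _ => networkField G f) 0 d z :=
    hz.congr_field fun t ht => hcl _ ((IsRightSolutionOn.norm_le (G := fun _ => G)
      (fun r hr => clampedFun_nonpos hf hB0 hr) (fun r hr => clampedFun_nonneg hf' hB0 hr) hz
      (Ico_subset_Icc_self ht)).trans hzR)
  have hδ0 : Tendsto (fun n => δ (φ n)) atTop (𝓝 0) :=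
    (hδ.mono_right nhdsWithin_le_nhds).comp hφ.tendsto_atTop
  have h1 : ∀ k, z 0 k ≤ c := fun k =>
    le_of_tendsto_of_tendsto' (tendsto_pi_nhds.1 hz0 k) (by simpa using hδ0.const_add c)
      fun n => hyc _ k
  have h2 : z 0 i ≤ c - η := le_of_tendsto' (tendsto_pi_nhds.1 hz0 i) fun n => hyi _
  have h3 : c ≤ z d j :=
    le_of_tendsto_of_tendsto' (by simpa using hδ0.const_sub c) (tendsto_pi_nhds.1 hzd j)
      fun n => (hyj _).le
  linarith [hz'.le_of_reachable hfc hf hf0 hd h1 hij h3]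

end Drop

/-! ### Spreading of low agents and convergence to consensus -/

section Convergence

variable {V : Type*} [Fintype V] {m : ℕ} {X : Fin m → WeightedGraph V} {σ : ℝ → Fin m} {t₀ : ℝ}
  {f : ℝ → ℝ}

/-- The drop happens during the first `d` units of time. Until the next chosen time the component
has no outside neighbours, so the maximum principle preserves it. There are finitely many topologies
and pairs of agents, hence one margin for all. -/
theorem exists_step (hfc : Continuous f)
    (hf : ∀ r ≤ 0, f r ≤ 0) (hf' : ∀ r, 0 ≤ r → 0 ≤ f r) (hf0 : ∀ r, f r = 0 → r = 0) {d : ℝ}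
    (hd : 0 < d)
    (hdw : ∀ s, t₀ ≤ s → (∀ t ∈ Ico s (s + d), σ t = σ s) →
        ∃ w ∈ Icc (s + d) (s + 2 * d), (∀ t ∈ Ico s w, σ t = σ s) ∧
          ∀ t ∈ Ico w (w + d), σ t = σ w)
    {x : ℝ → V → ℝ} (hx : ∀ b, IsRightSolutionOn (closedLoop X σ f) t₀ b x) {c : ℝ}
    (hc : ∀ δ > 0, ∀ᶠ t in atTop, ∀ k, x t k ≤ c + δ) {η : ℝ} (hη : 0 < η) :
    ∃ η' > 0, ∃ S, ∀ s, S ≤ s → (∀ t ∈ Ico s (s + d), σ t = σ s) →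
      ∃ s', s + d ≤ s' ∧ (∀ t ∈ Ico s s', σ t = σ s) ∧ (∀ t ∈ Ico s' (s' + d), σ t = σ s') ∧
        ∀ i l, (X (σ s)).graph.Reachable i l → x s i ≤ c - η → x s' l ≤ c - η' := by
  have hev : ∀ᶠ δ in 𝓝[>] (0 : ℝ), ∀ k i l, (X k).graph.Reachable i l → ∀ y : ℝ → V → ℝ,
      IsRightSolutionOn (fun _ => networkField (X k) f) 0 d y → ‖y 0‖ ≤ ‖x t₀‖ →
      (∀ k, y 0 k ≤ c + δ) → y 0 i ≤ c - η → y d l ≤ c - δ :=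
    eventually_all.2 fun k => eventually_all.2 fun i => eventually_all.2 fun l =>
      eventually_imp_distrib_left.2 fun hil =>
        eventually_le_sub_of_reachable (X k) hfc hf hf' hf0 hd hη _ c hil
  obtain ⟨δ, hδ, hδ0⟩ := (hev.and self_mem_nhdsWithin).exists
  obtain ⟨S, hS⟩ := eventually_atTop.1 (hc δ hδ0)
  refine ⟨δ, hδ0, max S t₀, fun s hs hgood => ?_⟩
  have hst : t₀ ≤ s := (le_max_right _ _).trans hs
  obtain ⟨s', hs', hconst, hgood'⟩ := hdw s hst hgood
  refine ⟨s', hs'.1, hconst, hgood', fun i l hil hi => ?_⟩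
  have hx1 : IsRightSolutionOn (fun _ => networkField (X (σ s)) f) s s' x :=
    ((hx s').mono hst le_rfl).congr_field fun t ht => by
      rw [closedLoop_eq_networkField]; simp only [hconst t ht]
  have hx2 := (hx1.mono le_rfl hs'.1).comp_add
  have h1 : ∀ k, (X (σ s)).graph.Reachable i k → x (s + d) k ≤ c - δ := fun k hk => by
    refine hδ (σ s) i k hk (fun t => x (s + t)) hx2 ?_ ?_ ?_
    · rw [add_zero]
      exact IsRightSolutionOn.norm_le hf hf' (hx s) ⟨hst, le_rfl⟩
    · rw [add_zero]; exact hS s ((le_max_left _ _).trans hs)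
    · rw [add_zero]; exact hi
  exact IsRightSolutionOn.forall_le (G := fun _ => X (σ s)) hf (hx1.mono (by linarith) le_rfl)
    (K := {k | (X (σ s)).graph.Reachable i k}) (fun _ _ k hk l hkl => hk.trans hkl.reachable)
    h1 s' ⟨hs'.1, le_rfl⟩ l hil

/-- Reachability is reflexive, so low agents stay low through each step while their current
neighbours join them; only the margin shrinks. -/
theorem exists_steps (hfc : Continuous f)
    (hf : ∀ r ≤ 0, f r ≤ 0) (hf' : ∀ r, 0 ≤ r → 0 ≤ f r) (hf0 : ∀ r, f r = 0 → r = 0) {d : ℝ}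
    (hd : 0 < d)
    (hdw : ∀ s, t₀ ≤ s → (∀ t ∈ Ico s (s + d), σ t = σ s) →
        ∃ w ∈ Icc (s + d) (s + 2 * d), (∀ t ∈ Ico s w, σ t = σ s) ∧
          ∀ t ∈ Ico w (w + d), σ t = σ w)
    {x : ℝ → V → ℝ} (hx : ∀ b, IsRightSolutionOn (closedLoop X σ f) t₀ b x) {c : ℝ}
    (hc : ∀ δ > 0, ∀ᶠ t in atTop, ∀ k, x t k ≤ c + δ) (n : ℕ) {η : ℝ} (hη : 0 < η) :
    ∃ η' > 0, ∃ S, ∀ s, S ≤ s → (∀ t ∈ Ico s (s + d), σ t = σ s) →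
      ∃ s', s + n * d ≤ s' ∧ (∀ t ∈ Ico s' (s' + d), σ t = σ s') ∧
        ∀ i, x s i ≤ c - η → x s' i ≤ c - η' ∧
          ∀ r ∈ Ico s s', ∀ l, (X (σ r)).graph.Adj i l → x s' l ≤ c - η' := by
  induction n with
  | zero =>
    refine ⟨η, hη, 0, fun s _ hgood => ⟨s, by simp, hgood, fun i hi => ⟨hi, by simp⟩⟩⟩
  | succ n ih =>
    obtain ⟨η₁, hη₁, S₁, h1⟩ := ih
    obtain ⟨η₂, hη₂, S₂, h2⟩ := exists_step hfc hf hf' hf0 hd hdw hx hc hη₁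
    refine ⟨η₂, hη₂, max S₁ S₂, fun s hs hgood => ?_⟩
    obtain ⟨s', hs', hgood', hlow⟩ := h1 s ((le_max_left _ _).trans hs) hgood
    have hnd : 0 ≤ (n : ℝ) * d := by positivity
    obtain ⟨s'', hs'', hconst, hgood'', hlow'⟩ :=
      h2 s' (((le_max_right _ _).trans hs).trans (by linarith)) hgood'
    refine ⟨s'', by push_cast; linarith, hgood'', fun i hi => ?_⟩
    refine ⟨hlow' i i (SimpleGraph.Reachable.refl i) (hlow i hi).1, fun r hr l hil => ?_⟩
    rcases lt_or_ge r s' with hrs | hrs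
    · exact hlow' l l (SimpleGraph.Reachable.refl l) ((hlow i hi).2 r ⟨hr.1, hrs⟩ l hil)
    · rw [hconst r ⟨hrs, hr.2⟩] at hil
      exact hlow' i l hil.reachable (hlow i hi).1

/-- The edges of a jointly connected window leave every nontrivial set of agents. -/
theorem IsJointlyConnected.exists_adj {V : Type*} {X : Fin m → WeightedGraph V} {τ : ℝ}
    (hX : IsJointlyConnected X σ t₀ τ) {s : ℝ} (hs : t₀ ≤ s) {L : Set V} {i k : V} (hi : i ∈ L)
    (hk : k ∉ L) : ∃ r ∈ Icc s (s + τ), ∃ j ∈ L, ∃ l ∉ L, (X (σ r)).graph.Adj j l := by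
  obtain ⟨p⟩ := (hX s hs).preconnected i k
  obtain ⟨e, -, h1, h2⟩ := p.exists_boundary_dart L hi hk
  have h3 := e.adj
  simp only [SimpleGraph.iSup_adj] at h3
  obtain ⟨r, hr, h4⟩ := h3
  exact ⟨r, hr, _, h1, _, h2, h4⟩

/-- Some agent is always at or above `c`, so the low set is never everything and joint connectivity
provides an edge leaving it. -/
theorem exists_card_le_low [DecidableEq V] (hfc : Continuous f)
    (hf : ∀ r ≤ 0, f r ≤ 0) (hf' : ∀ r, 0 ≤ r → 0 ≤ f r) (hf0 : ∀ r, f r = 0 → r = 0) {d : ℝ}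
    (hd : 0 < d)
    (hdw : ∀ s, t₀ ≤ s → (∀ t ∈ Ico s (s + d), σ t = σ s) →
        ∃ w ∈ Icc (s + d) (s + 2 * d), (∀ t ∈ Ico s w, σ t = σ s) ∧
          ∀ t ∈ Ico w (w + d), σ t = σ w)
    {τ : ℝ} (hX : IsJointlyConnected X σ t₀ τ)
    {x : ℝ → V → ℝ} (hx : ∀ b, IsRightSolutionOn (closedLoop X σ f) t₀ b x) {c : ℝ}
    (hc : ∀ δ > 0, ∀ᶠ t in atTop, ∀ k, x t k ≤ c + δ) (hc' : ∀ t, t₀ ≤ t → ∃ k, c ≤ x t k)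
    (n : ℕ) {η : ℝ} (hη : 0 < η) :
    ∃ η' > 0, ∃ S, ∀ s, S ≤ s → (∀ t ∈ Ico s (s + d), σ t = σ s) → (∃ i, x s i ≤ c - η) →
      ∃ s', s ≤ s' ∧ (∀ t ∈ Ico s' (s' + d), σ t = σ s') ∧
        ∃ L : Finset V, n < L.card ∧ ∀ i ∈ L, x s' i ≤ c - η' := by
  induction n with
  | zero =>
    refine ⟨η, hη, 0, fun s _ hgood ⟨i, hi⟩ => ⟨s, le_rfl, hgood, {i}, by simp, by simpa using hi⟩⟩
  | succ n ih =>
    obtain ⟨η₁, hη₁, S₁, h1⟩ := ih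
    -- `N` steps last longer than `τ`, so they include the time at which the leaving edge is active.
    obtain ⟨N, hN⟩ := exists_nat_gt (τ / d)
    rw [div_lt_iff₀ hd] at hN
    obtain ⟨η₂, hη₂, S₂, h2⟩ := exists_steps hfc hf hf' hf0 hd hdw hx hc N hη₁
    refine ⟨η₂, hη₂, max t₀ (max S₁ S₂), fun s hs hgood hlow => ?_⟩
    rw [max_le_iff, max_le_iff] at hs
    obtain ⟨s', hs', hgood', L, hL, hLlow⟩ := h1 s hs.2.1 hgood hlow
    obtain ⟨s'', hs'', hgood'', hlow'⟩ := h2 s' (hs.2.2.trans hs') hgood'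
    obtain ⟨k, hk⟩ := hc' s' (hs.1.trans hs')
    have hkL : k ∉ (L : Set V) := fun hkL => by linarith [hLlow k hkL]
    obtain ⟨i, hi⟩ := Finset.card_pos.1 (Nat.zero_lt_of_lt hL)
    obtain ⟨r, hr, j, hj, l, hl, hjl⟩ := hX.exists_adj (hs.1.trans hs') (L := L) hi hkL
    have hNd : s' ≤ s'' := by
      have : 0 ≤ (N : ℝ) * d := by positivity
      linarith
    refine ⟨s'', hs'.trans hNd, hgood'', insert l L, ?_, fun q hq => ?_⟩
    · rw [Finset.card_insert_of_notMem (by simpa using hl)]; omega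
    · rcases Finset.mem_insert.1 hq with rfl | hq
      · exact (hlow' j (hLlow j hj)).2 r ⟨hr.1, by linarith [hr.2]⟩ q hjl
      · exact (hlow' q (hLlow q hq)).1

theorem not_exists_gap (hσ : IsSwitchingSignal σ t₀) (hfc : Continuous f)
    (hf : ∀ r ≤ 0, f r ≤ 0) (hf' : ∀ r, 0 ≤ r → 0 ≤ f r) (hf0 : ∀ r, f r = 0 → r = 0)
    {τ : ℝ} (hX : IsJointlyConnected X σ t₀ τ)
    {x : ℝ → V → ℝ} (hx : ∀ b, IsRightSolutionOn (closedLoop X σ f) t₀ b x) {c : ℝ}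
    (hc : ∀ δ > 0, ∀ᶠ t in atTop, ∀ k, x t k ≤ c + δ) (hc' : ∀ t, t₀ ≤ t → ∃ k, c ≤ x t k)
    {c' : ℝ} (hlow : ∀ t, t₀ ≤ t → ∃ k, x t k ≤ c') : c ≤ c' := by
  classical
  by_contra! hlt
  obtain ⟨d, hd, hdw, hdw'⟩ := hσ.exists_dwell
  obtain ⟨η, -, S, h⟩ := exists_card_le_low hfc hf hf' hf0 hd hdw' hX hx hc hc'
    (Fintype.card V) (sub_pos.2 hlt)
  -- A late time that begins a constant stretch; from it more than `Fintype.card V` agents would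
  -- become low.
  obtain ⟨w, hw, -, hgood⟩ := hdw (max S t₀) (le_max_right _ _)
  obtain ⟨i, hi⟩ := hlow w ((le_max_right _ _).trans hw.1)
  obtain ⟨-, -, -, L, hL, -⟩ := h w ((le_max_left _ _).trans hw.1) hgood ⟨i, by linarith⟩
  exact absurd (Finset.card_le_univ L) (not_le.2 hL)

theorem exists_tendsto_consensusSet (hσ : IsSwitchingSignal σ t₀) (hfc : Continuous f)
    (hf : ∀ r ≤ 0, f r ≤ 0) (hf' : ∀ r, 0 ≤ r → 0 ≤ f r) (hf0 : ∀ r, f r = 0 → r = 0)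
    {τ : ℝ} (hX : IsJointlyConnected X σ t₀ τ)
    {x : ℝ → V → ℝ} (hx : ∀ b, IsRightSolutionOn (closedLoop X σ f) t₀ b x) :
    ∃ a ∈ consensusSet V, Tendsto x atTop (𝓝 a) := by
  have hne : Nonempty V := (hX t₀ le_rfl).nonempty
  have hne' : (Finset.univ : Finset V).Nonempty := Finset.univ_nonempty
  set M : ℝ → ℝ := fun t => Finset.univ.sup' hne' (x t)
  set μ : ℝ → ℝ := fun t => Finset.univ.inf' hne' (x t)
  have hM : ∀ t k, x t k ≤ M t := fun t k => Finset.le_sup' (x t) (Finset.mem_univ k)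
  have hμ : ∀ t k, μ t ≤ x t k := fun t k => Finset.inf'_le (x t) (Finset.mem_univ k)
  have hM' : ∀ t, ∃ k, M t = x t k := fun t => by
    obtain ⟨k, -, hk⟩ := Finset.exists_mem_eq_sup' hne' (x t); exact ⟨k, hk⟩
  have hμ' : ∀ t, ∃ k, μ t = x t k := fun t => by
    obtain ⟨k, -, hk⟩ := Finset.exists_mem_eq_inf' hne' (x t); exact ⟨k, hk⟩
  have hmem : ∀ s t, t₀ ≤ s → s ≤ t → ∀ k, x t k ∈ Icc (μ s) (M s) := fun s t hs hst =>
    IsRightSolutionOn.forall_mem_Icc hf hf' ((hx t).mono hs le_rfl)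
      (fun i => ⟨hμ s i, hM s i⟩) t ⟨hst, le_rfl⟩
  -- By monotonicity, `c` and `c'` are the limits of the maximum and the minimum.
  set c := sInf (M '' Ici t₀)
  set c' := sSup (μ '' Ici t₀)
  have hbM : BddBelow (M '' Ici t₀) := by
    refine ⟨μ t₀, ?_⟩
    rintro _ ⟨t, ht, rfl⟩
    obtain ⟨k, hk⟩ := hM' t
    rw [hk]; exact (hmem t₀ t le_rfl ht k).1
  have hbμ : BddAbove (μ '' Ici t₀) := by
    refine ⟨M t₀, ?_⟩
    rintro _ ⟨t, ht, rfl⟩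
    obtain ⟨k, hk⟩ := hμ' t
    rw [hk]; exact (hmem t₀ t le_rfl ht k).2
  have hcM : ∀ t, t₀ ≤ t → c ≤ M t := fun t ht => csInf_le hbM ⟨t, ht, rfl⟩
  have hcμ : ∀ t, t₀ ≤ t → μ t ≤ c' := fun t ht => le_csSup hbμ ⟨t, ht, rfl⟩
  have hupper : ∀ δ > 0, ∀ᶠ t in atTop, ∀ k, x t k ≤ c + δ := by
    intro δ hδ
    obtain ⟨_, ⟨s, hs, rfl⟩, hlt⟩ := exists_lt_of_csInf_lt (⟨_, t₀, self_mem_Ici, rfl⟩ :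
      (M '' Ici t₀).Nonempty) (lt_add_of_pos_right c hδ)
    filter_upwards [eventually_ge_atTop s] with t ht k
    exact (hmem s t hs ht k).2.trans hlt.le
  have hlower : ∀ δ > 0, ∀ᶠ t in atTop, ∀ k, c' - δ ≤ x t k := by
    intro δ hδ
    obtain ⟨_, ⟨s, hs, rfl⟩, hlt⟩ := exists_lt_of_lt_csSup (⟨_, t₀, self_mem_Ici, rfl⟩ :
      (μ '' Ici t₀).Nonempty) (sub_lt_self c' hδ)
    filter_upwards [eventually_ge_atTop s] with t ht k
    exact hlt.le.trans (hmem s t hs ht k).1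
  have hcc : c ≤ c' := not_exists_gap hσ hfc hf hf' hf0 hX hx hupper
    (fun t ht => (hM' t).imp fun _ hk => (hcM t ht).trans hk.le)
    (fun t ht => (hμ' t).imp fun _ hk => hk.ge.trans (hcμ t ht))
  refine ⟨fun _ => c, fun _ _ => rfl, tendsto_pi_nhds.2 fun k => ?_⟩
  rw [Metric.tendsto_nhds]
  intro ε hε
  filter_upwards [hupper (ε / 2) (by linarith), hlower (ε / 2) (by linarith)] with t h1 h2
  rw [Real.dist_eq, abs_lt]
  constructor <;> linarith [h1 k, h2 k]

end Convergence

theorem mainTheorem1 {V : Type*} [Fintype V] {m : ℕ} (X : Fin m → WeightedGraph V)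
    (σ : ℝ → Fin m) (t₀ : ℝ) (hσ : IsSwitchingSignal σ t₀)
    (τ : ℝ) (hτ : 0 < τ) (hX : IsJointlyConnected X σ t₀ τ)
    (f : ℝ → ℝ) (hf : Continuous f)
    (hstable : IsGloballyAsymptoticallyStable (fun _ x : ℝ => -f x) 0 {0}) :
    IsGloballyAsymptoticallyStable (closedLoop X σ f) t₀ (consensusSet V) := by
  have hzero : f 0 = 0 := hstable.apply_zero
  have hnonpos : ∀ r ≤ 0, f r ≤ 0 := fun r hr => by
    rcases hr.lt_or_eq with h | rfl
    · exact (hstable.apply_neg hf h).le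
    · exact hzero.le
  have hnonneg : ∀ r, 0 ≤ r → 0 ≤ f r := fun r hr => by
    rcases hr.lt_or_eq with h | rfl
    · exact (hstable.apply_pos hf h).le
    · exact hzero.ge
  have heq : ∀ r, f r = 0 → r = 0 := fun r hr => by
    by_contra hne
    rcases lt_or_gt_of_ne hne with h | h
    · exact (hstable.apply_neg hf h).ne hr
    · exact (hstable.apply_pos hf h).ne' hr
  refine ⟨fun a ha => ?_, fun x₀ => ?_, fun T hT x hx => ?_, fun ε hε => ?_, fun x hx => ?_⟩
  · refine isGlobalSolution_const fun t => funext fun i => ?_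
    simp [closedLoop, consensusError_of_mem_consensusSet _ ha, hzero]
  · obtain ⟨x, hx, hx₀⟩ :=
      exists_forall_isRightSolutionOn_closedLoop (X := X) hσ hf hnonpos hnonneg le_rfl x₀
    exact ⟨x, isGlobalSolution_closedLoop hf hnonpos hnonneg hx, hx₀⟩
  · exact exists_isGlobalSolution_eqOn_Ico hσ hf hnonpos hnonneg hT hx
  -- The sup distance to a consensus state never increases, so `δ = ε` works.
  · refine ⟨ε, hε, fun a ha x hx hxa t ht => lt_of_le_of_lt ?_ hxa⟩
    exact IsRightSolutionOn.dist_le hnonpos hnonneg (hx.isRightSolutionOn_closedLoop hσ hf t) ha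
      ⟨ht, le_rfl⟩
  · exact exists_tendsto_consensusSet hσ hf hnonpos hnonneg heq hX
      (hx.isRightSolutionOn_closedLoop hσ hf)
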